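/- **Setting.** Let $x(t+1)=f(x(t),u(t),w(t))$ with $f:\mathbb R^n\times\mathbb R^m\times\mathbb R^q\to\mathbb R^n$, constraint $(x,u)\in\mathbb Z$, disturbance $w(t)\in\mathbb W$, and feedback $u=\pi(x,v)$. Put $f_\pi(x,v,w)=f(x,\pi(x,v),w)$ and $\mathbb Z_\pi=\{(x,v):(x,\pi(x,v))\in\mathbb Z\}$. For a set $\Omega\subset\mathbb R^n$ let $\overline{\mathbb Z}=\{(z,v):(z+\epsilon,v)\in\mathbb Z_\pi\ \forall\epsilon\in\Omega\}$. Let $L:\mathbb R^n\times\mathbb R^m\to\mathbb R$ be continuous, $L_\pi(x,v)=L(x,\pi(x,v))$, $L_\pi^{\max}(z,v)=\max_{\epsilon\in\Omega}L_\pi(z+\epsilon,v)$, and let $\ell$ be either $L_\pi^{\max}$ or $L_\pi$. An input sequence $v$ generates from $z$ the nominal trajectory $\phi(0,z,v)=z$, $\phi(t+1,z,v)=f_\pi(\phi(t,z,v),v(t),0)$. It is admissible for horizon $N\in\mathbb N\cup\{\infty\}$ if $(\phi(t,z,v),v(t))\in\overline{\mathbb Z}$ for all $0\le t<N$. Let $\mathbb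 X_\infty$ be the set of $z$ having an admissible input sequence of infinite horizon, $J_N(z,v)=\sum_{t<N}\ell(\phi(t,z,v),v(t))$, $V_N(z)=\inf J_N(z,v)$ over inputs admissible for horizon $N$ ($+\infty$ if there is none), and $V_\infty(z)=\inf\limsup_{N\to\infty}J_N(z,v)$ over inputs admissible for the infinite horizon. No terminal cost and no terminal constraint are used. For every $N\in\mathbb N$, assume that a minimiser $v_N^*(\cdot;z)$ of $J_N(z,\cdot)$ over the inputs admissible for horizon $N$ exists whenever there is such an input, and that a minimiser $z_0^*(x)$ of $V_N(z)$ over all $z$ with $x\in\{z\}\oplus\Omega$ exists whenever $V_N(z)<\infty$ for some such $z$ (the tube problem is then called feasible at $x$); fix a choice of these minimisers. The closed loop with horizon $N$ is $$x(t+1)=f\big(x(t),\pi(x(t),v(0|t)),w(t)\big),\quad w(t)\in\mathbb W,\quad z(0|t)=z_0^*(x(t)),\quad v(\cdot|t)=v_N^*(\cdot;z(0|t)).$$ Its real cost is $\mathcal J_T^{\mathrm{cl,uc}}(x,N)=\sum_{t=0}^{T-1}L_\pi(x(t),v(0|t))$. Let $\mathbb Z_{\mathrm{cl}}(z)$ be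 the set of all $z_0^*(x^+)$ with $x^+\in\{f_\pi(z,v_N^*(0;z),0)\}\oplus\Omega$ at which the tube problem is feasible. Norms are Euclidean. $\mathcal K$ is the class of continuous strictly increasing $\alpha$ on $[0,\infty)$ with $\alpha(0)=0$, $\mathcal K_\infty$ its unbounded members, $\mathcal L$ the class of continuous strictly decreasing $\delta:[0,\infty)\to[0,\infty)$ with $\delta(t)\to0$ as $t\to\infty$, and $\beta\in\mathcal{KL}$ means $\beta(\cdot,t)\in\mathcal K$ for all $t\ge0$ and $\beta(r,\cdot)\in\mathcal L$ for all $r>0$. **Assumptions.** 1. $\mathbb Z,\mathbb W$ are compact and convex with nonempty interior, and $0\in\operatorname{int}\mathbb W$. 2. $\Omega$ is compact and robust control invariant: $x-z\in\Omega$, $(x,v)\in\mathbb Z_\pi$, $w\in\mathbb W$ imply $f_\pi(x,v,w)-f_\pi(z,v,0)\in\Omega$. The sets $\Omega$ and $\overline{\mathbb Z}$ have nonempty interior, and $\overline{\mathbb Z}\subseteq\mathbb Z_\pi$ (automatic if $0\in\Omega$). 3. $\ell$ is Lipschitz on $\mathbb Z_\pi$ with constant $\kappa_\ell>0$. 4.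 $(z_s,v_s)$ minimises $\ell$ over all $(z,v)\in\overline{\mathbb Z}$ with $z=f_\pi(z,v,0)$, it lies in $\operatorname{int}\overline{\mathbb Z}$, and $\ell(z_s,v_s)=0$ (a normalisation, achieved by adding a constant to $L$). 5. There are $\alpha_\ell\in\mathcal K_\infty$ and a bounded $\lambda:\mathbb R^n\to\mathbb R$ with $\lambda(f_\pi(z,v,0))-\lambda(z)\le\ell(z,v)-\ell(z_s,v_s)-\alpha_\ell(\|(z,v)-(z_s,v_s)\|)$ on $\overline{\mathbb Z}$. Moreover, for all $N\ge1$, all $z\in\mathbb X_\infty$ and all $z^+\in\mathbb Z_{\mathrm{cl}}(z)$, the same inequality holds with $v=v_N^*(0;z)$ and with $z^+$ in place of $f_\pi(z,v,0)$. 6. $(z_s,v_s)$ is exponentially reachable: there are $c>0$ and $\rho\in[0,1)$ such that every $z\in\mathbb X_\infty$ has an input $v$, admissible for the infinite horizon, with $\|(\phi(k,z,v),v(k))-(z_s,v_s)\|\le c\rho^k$ for all $k$. 7. The nominal system is locally $M$-step controllable at $(z_s,v_s)$: for each $\epsilon>0$ there is $\rho>0$ such that any $y,z$ within $\rho$ of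 $z_s$ admit an input steering $y$ to $z$ in exactly $M$ steps with all state-input pairs on the way within $\epsilon$ of $(z_s,v_s)$. 8. There is $\alpha_V\in\mathcal K_\infty$ with $|V_N(z)-V_N(z_s)|\le\alpha_V(\|z-z_s\|)$ for all $N\in\mathbb N$ and $z\in\mathbb X_\infty$. **Corollary.** $V_\infty$ is finite on $\mathbb X_\infty$. For all sufficiently large $N$, every closed loop with $x(0)\in\mathbb X_\infty\oplus\Omega$ is well posed at all times: the tube problem is feasible at $x(t)$ and $z(0|t)\in\mathbb X_\infty$. There exist $\beta\in\mathcal{KL}$ and $\epsilon_1\in\mathcal L$ such that, for all sufficiently large $N$, every sequence with $z(0)\in\mathbb X_\infty$ and $z(t+1)\in\mathbb Z_{\mathrm{cl}}(z(t))$ for all $t\ge0$ satisfies $$\|z(t)-z_s\|\le\max\{\beta(\|z(0)-z_s\|,t),\epsilon_1(N)\}\quad\text{for all }t\ge0. \tag{1}$$ For every such pair $\beta,\epsilon_1$ there are $\delta_3,\delta_4\in\mathcal L$ such that the following holds for all $N\ge1$, all $T\ge0$ and every closed loop with $x(0)\in\mathbb X_\infty\oplus\Omega$ that is well posed at all times $t\le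 T$. Put $z_0=z(0|0)$, $z_T=z(0|T)$, $\kappa=\max\{\beta(\|z_0-z_s\|,T),\epsilon_1(N)\}$, and let $\mathbb U$ be the set of inputs $v$ admissible for horizon $T$ from $z_0$ with $\|\phi(T,z_0,v)-z_s\|\le\kappa$. If $\ell=L_\pi^{\max}$, then $$\mathcal J_T^{\mathrm{cl,uc}}(x,N)\le\inf_{v\in\mathbb U}J_T(z_0,v)+T\delta_3(N)+\delta_4(T),$$ $$\mathcal J_T^{\mathrm{cl,uc}}(x,N)\le V_\infty(z_0)-V_\infty(z_T)+T\delta_3(N).$$ If $\ell=L_\pi$, then $$\mathcal J_T^{\mathrm{cl,uc}}(x,N)\le\inf_{v\in\mathbb U}J_T(z_0,v)+T\delta_3(N)+\delta_4(T)+T\kappa_\ell\max_{\epsilon\in\Omega}\|\epsilon\|,$$ $$\mathcal J_T^{\mathrm{cl,uc}}(x,N)\le V_\infty(z_0)-V_\infty(z_T)+T\delta_3(N)+T\kappa_\ell\max_{\epsilon\in\Omega}\|\epsilon\|.$$ (An infimum over the empty set is $+\infty$.) -/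

import Mathlib

open Filter Topology

namespace TubeMPC

noncomputable section

/-- `ℝᵏ` with its Euclidean norm. -/
abbrev Vec (k : ℕ) : Type := EuclideanSpace ℝ (Fin k)

/-! ### Comparison functions (only their values on `[0, ∞)` matter) -/

/-- Class `𝒦`: continuous, strictly increasing on `[0, ∞)`, zero at zero. -/
def IsK (α : ℝ → ℝ) : Prop :=
  ContinuousOn α (Set.Ici 0) ∧ StrictMonoOn α (Set.Ici 0) ∧ α 0 = 0

/-- Class `𝒦_∞`: unbounded functions of class `𝒦`. -/
def IsKInf (α : ℝ → ℝ) : Prop :=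
  IsK α ∧ Tendsto α atTop atTop

/-- Class `ℒ`: continuous, strictly decreasing on `[0, ∞)`, with limit zero at infinity
(hence positive). -/
def IsL (δ : ℝ → ℝ) : Prop :=
  ContinuousOn δ (Set.Ici 0) ∧ StrictAntiOn δ (Set.Ici 0) ∧ Tendsto δ atTop (𝓝 0)

/-- Class `𝒦ℒ`. At `r = 0` the requirement `β(r, ·) ∈ ℒ` has to be left out, since `β(0, t) = 0`
for every `t`. -/
def IsKL (β : ℝ → ℝ → ℝ) : Prop :=
  (∀ t : ℝ, 0 ≤ t → IsK (fun r => β r t)) ∧ (∀ r : ℝ, 0 < r → IsL (fun t => β r t))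

/-- Euclidean distance of two state-input pairs in `ℝⁿ × ℝᵐ`. -/
def pairDist {n m : ℕ} (z : Vec n) (v : Vec m) (z' : Vec n) (v' : Vec m) : ℝ :=
  Real.sqrt (‖z - z'‖ ^ 2 + ‖v - v'‖ ^ 2)

/-! ### The control system -/

/-- The data of the robust control problem: the dynamics `f`, the parameterised feedback `π`,
the constraint set `Zc` for pairs (state, input), the disturbance set `W`, the tube cross
section `Ω`, and the stage cost `L`. -/
structure Data (n m q : ℕ) where
  f : Vec n → Vec m → Vec q → Vec n
  π : Vec n → Vec m → Vec m
  Zc : Set (Vec n × Vec m)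
  W : Set (Vec q)
  Ω : Set (Vec n)
  L : Vec n → Vec m → ℝ

namespace Data

variable {n m q : ℕ} (S : Data n m q)

/-- `f_π(x, v, w) = f(x, π(x, v), w)`. -/
def fpi (x : Vec n) (v : Vec m) (w : Vec q) : Vec n := S.f x (S.π x v) w

/-- `ℤ_π = {(x, v) : (x, π(x, v)) ∈ ℤ}`. -/
def Zpi : Set (Vec n × Vec m) := {p | (p.1, S.π p.1 p.2) ∈ S.Zc}

/-- The tightened constraint set: `(z + ε, v) ∈ ℤ_π` for all `ε ∈ Ω`. -/
def Zbar : Set (Vec n × Vec m) := {p | ∀ ε ∈ S.Ω, (p.1 + ε, p.2) ∈ S.Zpi}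

/-- `L_π(x, v) = L(x, π(x, v))`. -/
def Lpi (x : Vec n) (v : Vec m) : ℝ := S.L x (S.π x v)

/-- The worst case stage cost `max_{ε ∈ Ω} L_π(z + ε, v)`. -/
def Lmax (z : Vec n) (v : Vec m) : ℝ := sSup ((fun ε => S.Lpi (z + ε) v) '' S.Ω)

/-- `max_{ε ∈ Ω} ‖ε‖`. -/
def tubeRadius : ℝ := sSup ((fun ε => ‖ε‖) '' S.Ω)

/-- `Ω` is robust control invariant for the error dynamics under the feedback `π`. -/
def IsRCI : Prop :=
  IsCompact S.Ω ∧
    ∀ (x z : Vec n) (v : Vec m) (w : Vec q), x - z ∈ S.Ω → (x, v) ∈ S.Zpi → w ∈ S.W →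
      S.fpi x v w - S.fpi z v 0 ∈ S.Ω

/-! ### Nominal trajectories and optimal control problems without terminal conditions -/

/-- The nominal trajectory `φ(t, z₀, v)`: `z(t+1) = f_π(z(t), v(t), 0)`, `z(0) = z₀`. -/
def traj (z₀ : Vec n) (v : ℕ → Vec m) : ℕ → Vec n
  | 0 => z₀
  | t + 1 => S.fpi (traj z₀ v t) (v t) 0

/-- `v` is admissible for the horizon `T` (only `v 0, …, v (T - 1)` matter). -/
def Adm (T : ℕ) (z₀ : Vec n) (v : ℕ → Vec m) : Prop :=
  ∀ t < T, (S.traj z₀ v t, v t) ∈ S.Zbar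

/-- `v` is admissible for the infinite horizon. -/
def AdmInf (z₀ : Vec n) (v : ℕ → Vec m) : Prop :=
  ∀ t, (S.traj z₀ v t, v t) ∈ S.Zbar

/-- `𝕏_∞`: the nominal states that have an admissible infinite input sequence. -/
def Xinf : Set (Vec n) := {z | ∃ v, S.AdmInf z v}

/-- `J_N(z₀, v) = ∑_{t < N} ℓ(z(t), v(t))`. -/
def cost (ℓ : Vec n → Vec m → ℝ) (N : ℕ) (z₀ : Vec n) (v : ℕ → Vec m) : ℝ :=
  ∑ t ∈ Finset.range N, ℓ (S.traj z₀ v t) (v t)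

/-- The optimal value `V_N(z₀)` without terminal conditions (`⊤` if `z₀` is infeasible). -/
def V (ℓ : Vec n → Vec m → ℝ) (N : ℕ) (z₀ : Vec n) : EReal :=
  ⨅ (v : ℕ → Vec m) (_ : S.Adm N z₀ v), (S.cost ℓ N z₀ v : EReal)

/-- `J_∞(z₀, v) = limsup_N J_N(z₀, v)`. -/
def costInf (ℓ : Vec n → Vec m → ℝ) (z₀ : Vec n) (v : ℕ → Vec m) : EReal :=
  limsup (fun N : ℕ => (S.cost ℓ N z₀ v : EReal)) atTop

/-- The infinite horizon optimal value `V_∞(z₀)`. -/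
def Vinf (ℓ : Vec n → Vec m → ℝ) (z₀ : Vec n) : EReal :=
  ⨅ (v : ℕ → Vec m) (_ : S.AdmInf z₀ v), S.costInf ℓ z₀ v

/-- `v` is optimal for the nominal problem with horizon `N` and initial state `z₀`. -/
def IsOptimalInput (ℓ : Vec n → Vec m → ℝ) (N : ℕ) (z₀ : Vec n) (v : ℕ → Vec m) : Prop :=
  S.Adm N z₀ v ∧ ∀ v', S.Adm N z₀ v' → S.cost ℓ N z₀ v ≤ S.cost ℓ N z₀ v'

/-- The tube problem at the real state `x` is feasible: some `z` with `x ∈ {z} ⊕ Ω` is feasible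
for the nominal problem with horizon `N`. -/
def TubeFeasible (N : ℕ) (x : Vec n) : Prop :=
  ∃ z, x - z ∈ S.Ω ∧ ∃ v, S.Adm N z v

/-- `z` solves the tube problem `min V_N(z)` subject to `x ∈ {z} ⊕ Ω`. -/
def IsOptimalTubeState (ℓ : Vec n → Vec m → ℝ) (N : ℕ) (x z : Vec n) : Prop :=
  x - z ∈ S.Ω ∧ (∃ v, S.Adm N z v) ∧ ∀ z', x - z' ∈ S.Ω → S.V ℓ N z ≤ S.V ℓ N z'

/-- The set `𝕌` of admissible inputs of length `T` from `z` with `‖φ(T, z, v) - z_s‖ ≤ κ`. -/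
def inputsTo (zs : Vec n) (κ : ℝ) (T : ℕ) (z : Vec n) : Set (ℕ → Vec m) :=
  {v | S.Adm T z v ∧ ‖S.traj z v T - zs‖ ≤ κ}

/-! ### Closed loop

`vstar N z` is the chosen minimiser `v_N^*(·; z)` of the nominal problem and `zstar N x` the chosen
minimiser `z_0^*(x)` of the tube problem. -/

/-- The set `Z_cl(z)` of possible next nominal states for the horizon `N`. -/
def Zcl (vstar : ℕ → Vec n → ℕ → Vec m) (zstar : ℕ → Vec n → Vec n) (N : ℕ) (z : Vec n) :
    Set (Vec n) :=
  {z' | ∃ x, x - S.fpi z (vstar N z 0) 0 ∈ S.Ω ∧ S.TubeFeasible N x ∧ z' = zstar N x}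

/-- `x` is a real closed-loop trajectory for the disturbance sequence `w`: at each time the input
`u(t) = π(x(t), v(0|t))` is applied, where `v(·|t) = v_N^*(·; z(0|t))`, `z(0|t) = z_0^*(x(t))`. -/
def IsClosedLoop (vstar : ℕ → Vec n → ℕ → Vec m) (zstar : ℕ → Vec n → Vec n) (N : ℕ)
    (x : ℕ → Vec n) (w : ℕ → Vec q) : Prop :=
  ∀ t, w t ∈ S.W ∧ x (t + 1) = S.f (x t) (S.π (x t) (vstar N (zstar N (x t)) 0)) (w t)

/-- The closed-loop cost of the real state, `∑_{t < T} L_π(x(t), v(0|t))`. -/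
def realCost (vstar : ℕ → Vec n → ℕ → Vec m) (zstar : ℕ → Vec n → Vec n) (N : ℕ)
    (x : ℕ → Vec n) (T : ℕ) : ℝ :=
  ∑ t ∈ Finset.range T, S.Lpi (x t) (vstar N (zstar N (x t)) 0)

/-- The tube problem is feasible at the real state `x`, and its solution `z_0^*(x)` lies
in `𝕏_∞`. -/
def WellPosedAt (zstar : ℕ → Vec n → Vec n) (N : ℕ) (x : Vec n) : Prop :=
  S.TubeFeasible N x ∧ zstar N x ∈ S.Xinf

/-! ### Assumptions -/

/-- The constraint sets are compact and convex with nonempty interior, and `0 ∈ int W`. -/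
def ConstraintSets : Prop :=
  IsCompact S.Zc ∧ Convex ℝ S.Zc ∧ (interior S.Zc).Nonempty ∧
    IsCompact S.W ∧ Convex ℝ S.W ∧ (0 : Vec q) ∈ interior S.W

/-- `Ω` is RCI, and `Ω` and the tightened constraint set have nonempty interior. The last clause
says that the stage cost, a function on `ℤ_π`, may be evaluated on the tightened set; it holds
automatically if `0 ∈ Ω`. -/
def TubeSets : Prop :=
  S.IsRCI ∧ (interior S.Ω).Nonempty ∧ (interior S.Zbar).Nonempty ∧ S.Zbar ⊆ S.Zpi

/-- `ℓ` is Lipschitz continuous on `ℤ_π` with constant `κ > 0`. -/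
def LipschitzCost (ℓ : Vec n → Vec m → ℝ) (κ : ℝ) : Prop :=
  0 < κ ∧ ∀ z v z' v', (z, v) ∈ S.Zpi → (z', v') ∈ S.Zpi →
    |ℓ z v - ℓ z' v'| ≤ κ * pairDist z v z' v'

/-- `(zs, vs)` is a robust optimal steady state. -/
def IsROSS (ℓ : Vec n → Vec m → ℝ) (zs : Vec n) (vs : Vec m) : Prop :=
  (zs, vs) ∈ S.Zbar ∧ zs = S.fpi zs vs 0 ∧
    ∀ z v, (z, v) ∈ S.Zbar → z = S.fpi z v 0 → ℓ zs vs ≤ ℓ z v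

/-- Strict dissipativity with bounded storage function `lam` and supply rate `ℓ - ℓ(zs, vs)`. -/
def StrictlyDissipative (ℓ : Vec n → Vec m → ℝ) (zs : Vec n) (vs : Vec m)
    (lam : Vec n → ℝ) (αl : ℝ → ℝ) : Prop :=
  IsKInf αl ∧ (∃ C : ℝ, ∀ z, |lam z| ≤ C) ∧
    ∀ z v, (z, v) ∈ S.Zbar →
      lam (S.fpi z v 0) - lam z ≤ (ℓ z v - ℓ zs vs) - αl (pairDist z v zs vs)

/-- The dissipation inequality along all closed-loop transitions of the nominal state. -/
def ClosedLoopDissipative (ℓ : Vec n → Vec m → ℝ) (zs : Vec n) (vs : Vec m)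
    (lam : Vec n → ℝ) (αl : ℝ → ℝ)
    (vstar : ℕ → Vec n → ℕ → Vec m) (zstar : ℕ → Vec n → Vec n) : Prop :=
  ∀ N : ℕ, 1 ≤ N → ∀ z ∈ S.Xinf, ∀ z' ∈ S.Zcl vstar zstar N z,
    lam z' - lam z ≤ (ℓ z (vstar N z 0) - ℓ zs vs) - αl (pairDist z (vstar N z 0) zs vs)

/-- `(zs, vs)` is exponentially reachable from every state in `𝕏_∞`. -/
def ExpReachable (zs : Vec n) (vs : Vec m) : Prop :=
  ∃ c ρ : ℝ, 0 < c ∧ 0 ≤ ρ ∧ ρ < 1 ∧ ∀ z ∈ S.Xinf, ∃ v, S.AdmInf z v ∧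
    ∀ k : ℕ, pairDist (S.traj z v k) (v k) zs vs ≤ c * ρ ^ k

/-- Local `M`-step controllability at `(zs, vs)`: states near `zs` can be steered to each other in
exactly `M` steps, with states and inputs remaining near `(zs, vs)`. -/
def LocallyControllable (M : ℕ) (zs : Vec n) (vs : Vec m) : Prop :=
  ∀ ε > 0, ∃ ρ > 0, ∀ y z : Vec n, ‖y - zs‖ ≤ ρ → ‖z - zs‖ ≤ ρ →
    ∃ v : ℕ → Vec m, S.traj y v M = z ∧
      ∀ t < M, pairDist (S.traj y v t) (v t) zs vs ≤ ε

/-- `|V_N(z) - V_N(zs)| ≤ αV(‖z - zs‖)` for all `N` and all `z ∈ 𝕏_∞`, with `αV ∈ 𝒦_∞`. -/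
def ValueContinuous (ℓ : Vec n → Vec m → ℝ) (zs : Vec n) : Prop :=
  ∃ αV : ℝ → ℝ, IsKInf αV ∧ ∀ N : ℕ, ∀ z ∈ S.Xinf,
    S.V ℓ N z ≤ S.V ℓ N zs + (αV ‖z - zs‖ : ℝ) ∧
    S.V ℓ N zs ≤ S.V ℓ N z + (αV ‖z - zs‖ : ℝ)

/-- Practical convergence of the closed-loop nominal state sequences with `β ∈ 𝒦ℒ`, `ε₁ ∈ ℒ`:
for all sufficiently large `N`, every sequence `z(t+1) ∈ Z_cl(z(t))` from `z(0) ∈ 𝕏_∞` satisfies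
`‖z(t) - zs‖ ≤ max {β(‖z(0) - zs‖, t), ε₁(N)}`. -/
def PracticallyConvergent (zs : Vec n)
    (vstar : ℕ → Vec n → ℕ → Vec m) (zstar : ℕ → Vec n → Vec n)
    (β : ℝ → ℝ → ℝ) (ε₁ : ℝ → ℝ) : Prop :=
  IsKL β ∧ IsL ε₁ ∧ ∀ᶠ N : ℕ in atTop, ∀ z : ℕ → Vec n, z 0 ∈ S.Xinf →
    (∀ t, z (t + 1) ∈ S.Zcl vstar zstar N (z t)) →
    ∀ t : ℕ, ‖z t - zs‖ ≤ max (β ‖z 0 - zs‖ t) (ε₁ N)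

end Data

end

end TubeMPC

namespace TubeMPC

/-! ### Comparison functions -/

/-! Everything rests on a turnpike argument. Summing strict dissipativity bounds the cost of an
admissible trajectory below by `∑ αl(distance to (zs, vs)) - 2C`, while exponential reachability
bounds optimal costs on `𝕏_∞` above by a constant `D`. A long optimal trajectory must therefore pass
arbitrarily close to `zs` at a time bounded independently of `N` (`exists_turnpike`,
`exists_optimal_turnpike`).

Cutting there and using dynamic programming, tails are compared with `V_K(zs)`, which is
nonincreasing in `K` because waiting at `zs` is free. This gives membership in `𝕏_∞` without
terminal constraints (`eventually_mem_Xinf`), an approximate Bellman decrease with unchanged horizon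
(`eventually_optCost_succ_le`), and `V_N - V_N(zs) ≈ V_∞ - V_∞(zs)` uniformly on `𝕏_∞`
(`eventually_optCost_sub_vinf_le`). The tube optimisation can only lower `V_N`, so these estimates
survive the choice of a new nominal state.

For convergence, `V_N + lam`, suitably shifted, is a practical Lyapunov function. For performance,
the stage cost is at most the drop of `V_∞` plus a small error and telescopes; the remaining
`V_∞(z_0) - V_∞(z_T)` is at most `J_T(z_0, v)` plus a small error, since both end points lie near
`zs`, where `V_∞` is continuous. Finally the real cost is dominated by the nominal one, through the
maximum over `Ω` or the Lipschitz constant. -/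

theorem IsK.nonneg {α : ℝ → ℝ} (h : IsK α) {x : ℝ} (hx : 0 ≤ x) : 0 ≤ α x := by
  have := h.2.1.monotoneOn (Set.mem_Ici.2 le_rfl) (Set.mem_Ici.2 hx) hx
  rwa [h.2.2] at this

theorem IsK.pos {α : ℝ → ℝ} (h : IsK α) {x : ℝ} (hx : 0 < x) : 0 < α x := by
  have := h.2.1 (Set.mem_Ici.2 le_rfl) (Set.mem_Ici.2 hx.le) hx
  rwa [h.2.2] at this

theorem IsK.mono {α : ℝ → ℝ} (h : IsK α) {x y : ℝ} (hx : 0 ≤ x) (hxy : x ≤ y) : α x ≤ α y :=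
  h.2.1.monotoneOn (Set.mem_Ici.2 hx) (Set.mem_Ici.2 (hx.trans hxy)) hxy

theorem IsK.exists_pos_le {α : ℝ → ℝ} (h : IsK α) {ε : ℝ} (hε : 0 < ε) :
    ∃ σ > 0, ∀ x, 0 ≤ x → x ≤ σ → α x ≤ ε := by
  have hc := h.1 0 (Set.mem_Ici.2 le_rfl)
  rw [Metric.continuousWithinAt_iff] at hc
  obtain ⟨σ, hσ, H⟩ := hc ε hε
  refine ⟨σ / 2, by positivity, fun x hx hxσ => ?_⟩
  have := H (Set.mem_Ici.2 hx) (by rw [Real.dist_eq, sub_zero, abs_of_nonneg hx]; linarith)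
  rw [h.2.2, Real.dist_eq, sub_zero] at this
  exact (le_abs_self _).trans this.le

theorem IsKInf.comp {α γ : ℝ → ℝ} (hα : IsKInf α) (hγ : IsKInf γ) :
    IsKInf (fun x => α (γ x)) := by
  have hm : Set.MapsTo γ (Set.Ici 0) (Set.Ici 0) := fun x hx => hγ.1.nonneg hx
  exact ⟨⟨hα.1.1.comp hγ.1.1 hm, hα.1.2.1.comp hγ.1.2.1 hm, by
    simp only [hγ.1.2.2, hα.1.2.2]⟩, hα.2.comp hγ.2⟩

theorem IsKInf.add {α γ : ℝ → ℝ} (hα : IsKInf α) (hγ : IsKInf γ) :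
    IsKInf (fun x => α x + γ x) :=
  ⟨⟨hα.1.1.add hγ.1.1, fun x hx y hy h => add_lt_add (hα.1.2.1 hx hy h) (hγ.1.2.1 hx hy h), by
    simp [hγ.1.2.2, hα.1.2.2]⟩, hα.2.atTop_add_atTop hγ.2⟩

theorem isKInf_const_mul {c : ℝ} (hc : 0 < c) : IsKInf (fun x => c * x) :=
  ⟨⟨by fun_prop, fun x _ y _ h => mul_lt_mul_of_pos_left h hc, by simp⟩,
    tendsto_id.const_mul_atTop hc⟩

theorem IsKInf.min_min {α γ : ℝ → ℝ} (hα : IsKInf α) (hγ : IsKInf γ) :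
    IsKInf (fun x => min (α x) (γ x)) := by
  refine ⟨⟨hα.1.1.inf hγ.1.1, fun x hx y hy h =>
    min_lt_min (hα.1.2.1 hx hy h) (hγ.1.2.1 hx hy h), by simp [hγ.1.2.2, hα.1.2.2]⟩, ?_⟩
  rw [tendsto_atTop]
  intro b
  filter_upwards [hα.2.eventually_ge_atTop b, hγ.2.eventually_ge_atTop b] with x h1 h2
  exact le_min h1 h2

/-- Every function of class `𝒦_∞` has an inverse of class `𝒦_∞`. -/
theorem IsKInf.exists_inv {α : ℝ → ℝ} (hα : IsKInf α) :
    ∃ γ, IsKInf γ ∧ (∀ x, 0 ≤ x → α (γ x) = x) ∧ ∀ x, 0 ≤ x → γ (α x) = x := by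
  -- Extending `α` by the identity on the negative axis gives an increasing bijection of `ℝ`.
  set h : ℝ → ℝ := fun x => α (max x 0) + min x 0 with hh
  have hpos : ∀ x, 0 ≤ x → h x = α x := fun x hx => by simp [hh, hx]
  have hcont : Continuous h := by
    refine Continuous.add ?_ (by fun_prop)
    exact hα.1.1.comp_continuous (by fun_prop) fun x => Set.mem_Ici.2 (le_max_right _ _)
  have hmono : StrictMono h := by
    intro x y hxy
    rcases le_or_gt y 0 with hy | hy
    · simp only [hh, max_eq_right hy, max_eq_right (hxy.le.trans hy), min_eq_left hy,
        min_eq_left (hxy.le.trans hy)]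
      linarith
    · have h1 : α (max x 0) < α (max y 0) := by
        refine hα.1.2.1 (Set.mem_Ici.2 (le_max_right _ _)) (Set.mem_Ici.2 (le_max_right _ _)) ?_
        rw [max_eq_left hy.le]
        exact max_lt hxy hy
      exact add_lt_add_of_lt_of_le h1 (min_le_min hxy.le le_rfl)
  have htop : Tendsto h atTop atTop := by
    refine hα.2.congr' ?_
    filter_upwards [eventually_ge_atTop 0] with x hx using (hpos x hx).symm
  have hbot : Tendsto h atBot atBot := by
    refine tendsto_id.congr' ?_
    filter_upwards [eventually_le_atBot 0] with x hx
    simp [hh, hx, hα.1.2.2]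
  have hsurj : Function.Surjective h := hcont.surjective htop hbot
  let e := hmono.orderIsoOfSurjective h hsurj
  have he : ∀ x, e x = h x := fun x => rfl
  have he0 : e.symm 0 = 0 := by
    rw [e.symm_apply_eq, he, hpos 0 le_rfl, hα.1.2.2]
  have hnn : ∀ x, 0 ≤ x → 0 ≤ e.symm x := fun x hx => by
    rw [← he0]; exact e.symm.monotone hx
  refine ⟨e.symm, ⟨⟨e.symm.continuous.continuousOn, e.symm.strictMono.strictMonoOn _, he0⟩,
    e.symm.tendsto_atTop⟩, fun x hx => ?_, fun x hx => ?_⟩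
  · rw [← hpos _ (hnn x hx), ← he, e.apply_symm_apply]
  · rw [← hpos x hx, ← he, e.symm_apply_apply]

/-- Decay like `1 / (t + 1)` inside a `𝒦_∞` function is all that the Lyapunov argument of
`exists_practical_bound` produces. -/
theorem IsKInf.isKL {θ b : ℝ → ℝ} (hθ : IsKInf θ) (hb : IsKInf b) :
    IsKL (fun r t => θ (b r / (t + 1))) := by
  constructor
  · intro t ht
    have ht' : 0 < (t + 1)⁻¹ := by positivity
    have := (hθ.comp ((isKInf_const_mul ht').comp hb)).1
    simpa only [div_eq_inv_mul] using this
  · intro r hr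
    have hbr := hb.1.pos hr
    refine ⟨?_, ?_, ?_⟩
    · refine hθ.1.1.comp (ContinuousOn.div continuousOn_const (by fun_prop) fun t ht => ?_) ?_
      · have : (0 : ℝ) ≤ t := ht
        positivity
      · intro t ht
        have : (0 : ℝ) ≤ t := ht
        simp only [Set.mem_Ici]
        positivity
    · intro s hs t ht hst
      have hs' : (0 : ℝ) ≤ s := hs
      have ht' : (0 : ℝ) ≤ t := ht
      refine hθ.1.2.1 (Set.mem_Ici.2 (by positivity)) (Set.mem_Ici.2 (by positivity)) ?_
      exact div_lt_div_of_pos_left hbr (by positivity) (by linarith)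
    · have h1 : Tendsto (fun t : ℝ => b r / (t + 1)) atTop (𝓝 0) :=
        tendsto_const_nhds.div_atTop (tendsto_atTop_add_const_right _ _ tendsto_id)
      have h2 : Tendsto (fun t : ℝ => b r / (t + 1)) atTop (𝓝[Set.Ici 0] 0) := by
        rw [tendsto_nhdsWithin_iff]
        refine ⟨h1, ?_⟩
        filter_upwards [eventually_ge_atTop 0] with t ht
        simp only [Set.mem_Ici]
        positivity
      have h3 := (hθ.1.1 0 (Set.mem_Ici.2 le_rfl)).tendsto.comp h2
      rw [hθ.1.2.2] at h3
      exact h3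

theorem IsL.pos {δ : ℝ → ℝ} (h : IsL δ) {t : ℝ} (ht : 0 ≤ t) : 0 < δ t := by
  have h1 : δ (t + 1) < δ t := h.2.1 ht (by simp only [Set.mem_Ici]; linarith) (by linarith)
  have h2 : 0 ≤ δ (t + 1) := by
    refine le_of_tendsto h.2.2 ?_
    filter_upwards [eventually_ge_atTop (t + 1)] with s hs
    exact h.2.1.antitoneOn (by simp only [Set.mem_Ici]; linarith)
      (by simp only [Set.mem_Ici]; linarith) hs
  linarith

/-- Every null sequence has a majorant of class `ℒ`. -/
theorem exists_isL_ge {e : ℕ → ℝ} (he : Tendsto e atTop (𝓝 0)) :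
    ∃ δ, IsL δ ∧ ∀ N : ℕ, e N ≤ δ N := by
  obtain ⟨C, hC⟩ : ∃ C, ∀ k, |e k| ≤ C := by
    obtain ⟨C, hC⟩ := (Metric.isBounded_range_of_tendsto e he).exists_norm_le
    exact ⟨C, fun k => hC _ ⟨k, rfl⟩⟩
  have hC0 : 0 ≤ C := (abs_nonneg _).trans (hC 0)
  -- Cutoffs equal to `1` up to `k`, to `0` from `k + 1` on, and linear between. The supremum of `|e
  -- k| * φ k` is then antitone and Lipschitz; adding `1 / (t + 1)` makes it strictly decreasing.
  let φ : ℕ → ℝ → ℝ := fun k t => max 0 (min 1 ((k : ℝ) + 1 - t))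
  have hφ0 : ∀ k t, 0 ≤ φ k t := fun k t => le_max_left _ _
  have hφ1 : ∀ k t, φ k t ≤ 1 := fun k t => max_le zero_le_one (min_le_left _ _)
  have hanti : ∀ k, Antitone (φ k) := fun k s t hst =>
    max_le_max le_rfl (min_le_min le_rfl (by linarith))
  have hlip : ∀ k s t, φ k s ≤ φ k t + |s - t| := by
    intro k s t
    have h1 := neg_abs_le (s - t)
    refine max_le (add_nonneg (hφ0 _ _) (abs_nonneg _)) ?_
    have h3 : min 1 ((k : ℝ) + 1 - t) ≤ φ k t := le_max_right _ _
    rcases le_total 1 ((k : ℝ) + 1 - t) with h | h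
    · rw [min_eq_left h] at h3
      exact (min_le_left _ _).trans (by linarith [abs_nonneg (s - t)])
    · rw [min_eq_right h] at h3
      exact (min_le_right _ _).trans (by linarith)
  let g : ℝ → ℝ := fun t => ⨆ k, |e k| * φ k t
  have hbdd : ∀ t, BddAbove (Set.range fun k => |e k| * φ k t) := fun t => ⟨C, by
    rintro _ ⟨k, rfl⟩
    exact (mul_le_of_le_one_right (abs_nonneg _) (hφ1 k t)).trans (hC k)⟩
  have hg0 : ∀ t, 0 ≤ g t := fun t => Real.iSup_nonneg fun k =>
    mul_nonneg (abs_nonneg _) (hφ0 k t)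
  have hganti : Antitone g := fun s t hst =>
    ciSup_mono (hbdd s) fun k => mul_le_mul_of_nonneg_left (hanti k hst) (abs_nonneg _)
  have hglip : ∀ s t, g s ≤ g t + C * dist s t := by
    intro s t
    refine ciSup_le fun k => ?_
    have h1 : |e k| * φ k t ≤ g t := le_ciSup (hbdd t) k
    have h2 := mul_le_mul_of_nonneg_left (hlip k s t) (abs_nonneg (e k))
    have h3 := mul_le_mul_of_nonneg_right (hC k) (abs_nonneg (s - t))
    rw [Real.dist_eq]
    linarith
  have hgcont : Continuous g :=
    (LipschitzWith.of_le_add_mul ⟨C, hC0⟩ hglip).continuous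
  have hglim : Tendsto g atTop (𝓝 0) := by
    rw [Metric.tendsto_atTop]
    intro ε hε
    obtain ⟨K, hK⟩ := (Metric.tendsto_atTop.1 he) (ε / 2) (by positivity)
    refine ⟨K + 1, fun t ht => ?_⟩
    rw [Real.dist_eq, sub_zero, abs_of_nonneg (hg0 t)]
    refine lt_of_le_of_lt (ciSup_le fun k => ?_) (half_lt_self hε)
    rcases lt_or_ge k K with hk | hk
    · have hk' : (k : ℝ) < K := by exact_mod_cast hk
      have : φ k t = 0 := max_eq_left ((min_le_right _ _).trans (by linarith))
      rw [this, mul_zero]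
      positivity
    · have := hK k hk
      rw [Real.dist_eq, sub_zero] at this
      exact (mul_le_of_le_one_right (abs_nonneg _) (hφ1 k t)).trans this.le
  refine ⟨fun t => g t + 1 / (t + 1), ⟨?_, ?_, ?_⟩, fun N => ?_⟩
  · refine hgcont.continuousOn.add (ContinuousOn.div continuousOn_const (by fun_prop) ?_)
    intro t ht
    have : (0 : ℝ) ≤ t := ht
    positivity
  · intro s hs t ht hst
    have hs' : (0 : ℝ) ≤ s := hs
    have h1 : 1 / (t + 1) < 1 / (s + 1) :=
      one_div_lt_one_div_of_lt (by positivity) (by linarith)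
    have h2 := hganti hst.le
    simp only
    linarith
  · have h1 : Tendsto (fun t : ℝ => 1 / (t + 1)) atTop (𝓝 0) :=
      tendsto_const_nhds.div_atTop (tendsto_atTop_add_const_right _ _ tendsto_id)
    simpa using hglim.add h1
  · have h1 : |e N| * φ N N ≤ g N := le_ciSup (hbdd N) N
    have h2 : φ N N = 1 := by simp [φ]
    rw [h2, mul_one] at h1
    have h3 : (0 : ℝ) ≤ 1 / (N + 1) := by positivity
    linarith [le_abs_self (e N)]

/-- If `P N ε` holds eventually for every `ε > 0`, then `ε` may be chosen as a function of class
`ℒ` of `N`. -/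
theorem exists_isL {P : ℕ → ℝ → Prop} (hmono : ∀ N a b, a ≤ b → P N a → P N b)
    (h : ∀ ε > 0, ∀ᶠ N in atTop, P N ε) :
    ∃ δ, IsL δ ∧ ∀ N : ℕ, (∃ ε, P N ε) → P N (δ N) := by
  let A : ℕ → Set ℝ := fun N => {ε | 0 ≤ ε ∧ P N ε}
  have hbdd : ∀ N, BddBelow (A N) := fun N => ⟨0, fun ε hε => hε.1⟩
  have hA0 : ∀ N, 0 ≤ sInf (A N) := fun N => Real.sInf_nonneg fun ε hε => hε.1
  have hlim : Tendsto (fun N => sInf (A N)) atTop (𝓝 0) := by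
    rw [Metric.tendsto_atTop']
    intro ε hε
    obtain ⟨K, hK⟩ := eventually_atTop.1 (h (ε / 2) (by positivity))
    refine ⟨K, fun N hN => ?_⟩
    rw [Real.dist_eq, sub_zero, abs_of_nonneg (hA0 N)]
    have : sInf (A N) ≤ ε / 2 := csInf_le (hbdd N) ⟨by positivity, hK N hN.le⟩
    linarith
  -- The infimum need not be attained; the extra null term leaves room for an actual member below
  -- it.
  have hlim' : Tendsto (fun N : ℕ => sInf (A N) + 1 / ((N : ℝ) + 1)) atTop (𝓝 0) := by
    simpa using hlim.add tendsto_one_div_add_atTop_nhds_zero_nat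
  obtain ⟨δ, hδ, hle⟩ := exists_isL_ge hlim'
  refine ⟨δ, hδ, fun N ⟨ε, hε⟩ => ?_⟩
  have hne : (A N).Nonempty := ⟨max ε 0, le_max_right _ _, hmono _ _ _ (le_max_left _ _) hε⟩
  have h1 : (0 : ℝ) < 1 / ((N : ℝ) + 1) := by positivity
  obtain ⟨a, ha, hlt⟩ := exists_lt_of_csInf_lt hne (lt_add_of_pos_right (sInf (A N)) h1)
  exact hmono _ _ _ (hlt.le.trans (hle N)) ha.2

/-- A bounded family of numbers indexed by distances that vanishes at distance zero has a
majorant of class `𝒦_∞`. -/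
theorem exists_isKInf_ge {X : Type*} (r g : X → ℝ) (hr : ∀ x, 0 ≤ r x) {C : ℝ}
    (hg : ∀ x, g x ≤ C) (h : ∀ ε > 0, ∃ σ > 0, ∀ x, r x ≤ σ → g x ≤ ε) :
    ∃ b, IsKInf b ∧ ∀ x, g x ≤ b (r x) := by
  obtain ⟨δ, hδ, H⟩ := exists_isL
    (P := fun N ε => ∀ x, r x * ((N : ℝ) + 1) ≤ 1 → g x ≤ ε)
    (fun N a b hab hP x hx => (hP x hx).trans hab) (fun ε hε => by
      obtain ⟨σ, hσ, hσ'⟩ := h ε hε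
      obtain ⟨K, hK⟩ := exists_nat_gt (1 / σ)
      filter_upwards [eventually_ge_atTop K] with N hN x hx
      refine hσ' x ?_
      by_contra hlt
      push Not at hlt
      rw [div_lt_iff₀ hσ] at hK
      have hN' : (K : ℝ) ≤ N := by exact_mod_cast hN
      have : (1 : ℝ) < 1 := calc
        (1 : ℝ) < K * σ := hK
        _ ≤ (N + 1) * σ := mul_le_mul_of_nonneg_right (by linarith) hσ.le
        _ ≤ (N + 1) * r x := mul_le_mul_of_nonneg_left hlt.le (by positivity)
        _ ≤ 1 := by linarith
      exact lt_irrefl _ this)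
  have H' : ∀ (N : ℕ) x, r x * ((N : ℝ) + 1) ≤ 1 → g x ≤ δ N := fun N =>
    H N ⟨C, fun x _ => hg x⟩
  let D := max C 0
  -- `δ N` controls `g` where `r ≤ 1 / (N + 1)`. If `N + 1 ≤ 1 / r < N + 2`, then `1 / r - 2 < N`,
  -- so the shift by two gives `δ N ≤ ψ r`. The linear term added below provides growth and covers
  -- `r > 1`.
  let ψ : ℝ → ℝ := fun s => δ (max (s⁻¹ - 2) 0)
  have hψanti : ∀ {s t : ℝ}, 0 < s → s ≤ t → ψ s ≤ ψ t := by
    intro s t hs hst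
    refine hδ.2.1.antitoneOn (Set.mem_Ici.2 (le_max_right _ _))
      (Set.mem_Ici.2 (le_max_right _ _)) (max_le_max ?_ le_rfl)
    have := inv_anti₀ hs hst
    linarith
  have hψpos : ∀ s, 0 < ψ s := fun s => hδ.pos (le_max_right _ _)
  let b : ℝ → ℝ := fun s => if s ≤ 0 then 0 else ψ s + (1 + 2 * D) * s
  have hbpos : ∀ s, 0 < s → b s = ψ s + (1 + 2 * D) * s := fun s hs => by
    simp only [b, if_neg (not_le.2 hs)]
  have hb0 : b 0 = 0 := by simp [b]
  have hD0 : 0 ≤ D := le_max_right _ _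
  refine ⟨b, ⟨⟨?_, ?_, hb0⟩, ?_⟩, fun x => ?_⟩
  · intro s hs
    rcases (show (0 : ℝ) ≤ s from hs).eq_or_lt with h0 | h0
    · subst h0
      have hlim : Tendsto (fun s : ℝ => ψ s + (1 + 2 * D) * s) (𝓝[>] 0) (𝓝 0) := by
        have h1 : Tendsto (fun s : ℝ => max (s⁻¹ - 2) 0) (𝓝[>] 0) atTop := by
          refine tendsto_atTop_mono (fun s => le_max_left _ _) ?_
          exact tendsto_atTop_add_const_right _ _ tendsto_inv_nhdsGT_zero
        have h2 : Tendsto (fun s : ℝ => (1 + 2 * D) * s) (𝓝[>] 0) (𝓝 0) := by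
          have : Tendsto (fun s : ℝ => (1 + 2 * D) * s) (𝓝 0) (𝓝 ((1 + 2 * D) * 0)) :=
            tendsto_id.const_mul _
          rw [mul_zero] at this
          exact this.mono_left nhdsWithin_le_nhds
        simpa using (hδ.2.2.comp h1).add h2
      have hlim' : Tendsto b (𝓝[>] 0) (𝓝 0) := hlim.congr' (by
        filter_upwards [self_mem_nhdsWithin] with s hs using (hbpos s hs).symm)
      have : ContinuousWithinAt b (Set.Ioi 0) 0 := by
        rw [ContinuousWithinAt, hb0]; exact hlim'
      exact continuousWithinAt_Ioi_iff_Ici.1 this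
    · have h1 : ContinuousAt ψ s := by
        have hc : Continuous fun t : ℝ => δ (max t 0) :=
          hδ.1.comp_continuous (by fun_prop) fun x => Set.mem_Ici.2 (le_max_right _ _)
        have h2 : ContinuousAt (fun s : ℝ => s⁻¹ - 2) s :=
          (continuousAt_inv₀ h0.ne').sub continuousAt_const
        exact hc.continuousAt.comp_of_eq h2 rfl
      have h3 : ContinuousAt (fun s => ψ s + (1 + 2 * D) * s) s :=
        h1.add (by fun_prop)
      refine (h3.congr ?_).continuousWithinAt
      filter_upwards [lt_mem_nhds h0] with t ht using (hbpos t ht).symm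
  · intro s hs t ht hst
    have h0t : 0 < t := lt_of_le_of_lt hs hst
    rcases (show (0 : ℝ) ≤ s from hs).eq_or_lt with h0 | h0
    · rw [← h0, hb0, hbpos t h0t]
      have := hψpos t
      positivity
    · rw [hbpos t h0t, hbpos s h0]
      have h1 := hψanti h0 hst.le
      have h2 := mul_lt_mul_of_pos_left hst (show 0 < 1 + 2 * D by positivity)
      linarith
  · refine tendsto_atTop_mono' _ ?_ tendsto_id
    filter_upwards [eventually_gt_atTop 0] with s hs
    rw [hbpos s hs]
    have := hψpos s
    have h2 : 0 ≤ 2 * D * s := by positivity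
    simp only [id]
    linarith
  · rcases (hr x).eq_or_lt with h0 | h0
    · rw [← h0, hb0]
      refine le_of_forall_pos_le_add fun ε hε => ?_
      obtain ⟨σ, hσ, hσ'⟩ := h ε hε
      rw [zero_add]
      exact hσ' x (h0 ▸ hσ.le)
    · rw [hbpos _ h0]
      have hψ := hψpos (r x)
      rcases le_or_gt (r x) 1 with h1 | h1
      · have hinv : 1 ≤ (r x)⁻¹ := (one_le_inv₀ h0).2 h1
        have hfl : 1 ≤ ⌊(r x)⁻¹⌋₊ := Nat.le_floor (by exact_mod_cast hinv)
        obtain ⟨N, hN⟩ := Nat.exists_eq_add_of_le' hfl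
        have h2 : ((N : ℝ) + 1) ≤ (r x)⁻¹ := by
          have := Nat.floor_le (inv_nonneg.2 h0.le)
          rw [hN] at this
          exact_mod_cast this
        have h3 : (r x)⁻¹ < (N : ℝ) + 1 + 1 := by
          have := Nat.lt_floor_add_one (r x)⁻¹
          rw [hN] at this
          exact_mod_cast this
        have h4 : g x ≤ δ N := H' N x (by
          have := mul_le_mul_of_nonneg_left h2 h0.le
          rwa [mul_inv_cancel₀ h0.ne'] at this)
        have h5 : δ N ≤ ψ (r x) := hδ.2.1.antitoneOn (Set.mem_Ici.2 (le_max_right _ _))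
          (Set.mem_Ici.2 N.cast_nonneg) (max_le (by linarith) N.cast_nonneg)
        have : 0 ≤ (1 + 2 * D) * r x := by positivity
        linarith
      · have h6 : g x ≤ D := (hg x).trans (le_max_left _ _)
        have h7 : D * 1 ≤ D * r x := mul_le_mul_of_nonneg_left h1.le hD0
        nlinarith

/-- Practical convergence of a scalar sequence that admits a practical Lyapunov function with
comparison functions `a`, `b` and error `d`. -/
theorem exists_practical_bound {a b : ℝ → ℝ} (ha : IsKInf a) (hb : IsKInf b) :
    ∃ β χ, IsKL β ∧ IsKInf χ ∧ ∀ (r W : ℕ → ℝ) (d : ℝ), 0 ≤ d → (∀ t, 0 ≤ r t) →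
      (∀ t, a (r t) ≤ W t) → (∀ t, W t ≤ b (r t) + 2 * d) →
      (∀ t, W (t + 1) ≤ W t - a (r t) + d) →
      ∀ t : ℕ, r t ≤ max (β (r 0) t) (χ d) := by
  obtain ⟨ai, hai, -, hai2⟩ := ha.exists_inv
  obtain ⟨bi, hbi, -, hbi2⟩ := hb.exists_inv
  have hρ : IsKInf fun s => min (1 / 2 * a (bi (1 / 2 * s))) (1 * s) :=
    ((isKInf_const_mul (by norm_num)).comp
      (ha.comp (hbi.comp (isKInf_const_mul (by norm_num))))).min_min (isKInf_const_mul one_pos)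
  -- If `W > 4d`, then `b(r) ≥ W / 2`, hence `a(r) ≥ 2ρ(W)`; one copy of `ρ(W)` absorbs the error
  -- `d` once `W ≥ ρi d`. The bound `ρ(s) ≤ s` later turns `tρ(W) + W` into a multiple `t + 1` of
  -- `ρ(W)`.
  set ρ : ℝ → ℝ := fun s => min (1 / 2 * a (bi (1 / 2 * s))) (1 * s) with hρdef
  obtain ⟨ρi, hρi, hρi1, hρi2⟩ := hρ.exists_inv
  refine ⟨fun r t => ai (ρi (2 * b r / (t + 1))), fun d => ai (5 * d + ρi d),
    (hai.comp hρi).isKL ((isKInf_const_mul two_pos).comp hb),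
    hai.comp ((isKInf_const_mul (by norm_num)).add hρi), ?_⟩
  intro r W d hd hr haW hWb hW t
  have hW0 : ∀ t, 0 ≤ W t := fun t => (ha.1.nonneg (hr t)).trans (haW t)
  have hρd : 0 ≤ ρi d := hρi.1.nonneg hd
  have hstep : ∀ t, 4 * d + ρi d < W t → W (t + 1) ≤ W t - ρ (W t) := by
    intro t ht
    have h1 : 1 / 2 * W t ≤ b (r t) := by linarith [hWb t]
    have h2 : bi (1 / 2 * W t) ≤ r t := by
      have := hbi.1.mono (by linarith [hW0 t]) h1
      rwa [hbi2 _ (hr t)] at this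
    have h3 : a (bi (1 / 2 * W t)) ≤ a (r t) :=
      ha.1.mono (hbi.1.nonneg (by linarith [hW0 t])) h2
    have h4 : ρ (W t) ≤ 1 / 2 * a (bi (1 / 2 * W t)) := min_le_left _ _
    have h5 : d ≤ ρ (W t) := by
      have := hρ.1.mono hρd (show ρi d ≤ W t by linarith)
      rwa [hρi1 d hd] at this
    linarith [hW t]
  -- Either the residual level is reached, where one step from below `4d + ρi d` adds at most `d`,
  -- or each step so far has dropped by at least the current value of `ρ(W)`.
  have hind : ∀ t : ℕ, W t ≤ 5 * d + ρi d ∨ (t : ℝ) * ρ (W t) + W t ≤ W 0 := by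
    intro t
    induction t with
    | zero => right; simp
    | succ t ih =>
      rcases le_or_gt (W t) (4 * d + ρi d) with h | h
      · left
        linarith [hW t, ha.1.nonneg (hr t)]
      · have h1 := hstep t h
        have h2 := hρ.1.nonneg (hW0 t)
        rcases ih with ih | ih
        · left; linarith
        · right
          have h3 : ρ (W (t + 1)) ≤ ρ (W t) := hρ.1.mono (hW0 _) (by linarith)
          have h4 := mul_le_mul_of_nonneg_left h3 (show (0 : ℝ) ≤ t + 1 by positivity)
          push_cast
          linarith
  have hfin : ∀ s, W t ≤ s → r t ≤ ai s := by
    intro s hs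
    have := hai.1.mono (ha.1.nonneg (hr t)) ((haW t).trans hs)
    rwa [hai2 _ (hr t)] at this
  rcases hind t with h | h
  · exact (hfin _ h).trans (le_max_right _ _)
  · have h2 := hρ.1.nonneg (hW0 t)
    rcases le_or_gt (W 0) (5 * d + ρi d) with h0 | h0
    · refine (hfin _ ?_).trans (le_max_right _ _)
      have := mul_nonneg (Nat.cast_nonneg (α := ℝ) t) h2
      linarith
    · refine (hfin _ ?_).trans (le_max_left _ _)
      have h3 : ρ (W t) ≤ 1 * W t := min_le_right _ _
      have h4 : ρ (W t) * ((t : ℝ) + 1) ≤ 2 * b (r 0) := by linarith [hWb 0]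
      have h5 : ρ (W t) ≤ 2 * b (r 0) / (t + 1) := by
        rw [le_div_iff₀ (by positivity)]; exact h4
      have := hρi.1.mono h2 h5
      rwa [hρi2 _ (hW0 t)] at this

theorem le_pairDist {n m : ℕ} (z : Vec n) (v : Vec m) (z' : Vec n) (v' : Vec m) :
    ‖z - z'‖ ≤ pairDist z v z' v' ∧ ‖v - v'‖ ≤ pairDist z v z' v' := by
  constructor <;>
  · refine Real.le_sqrt_of_sq_le ?_
    nlinarith [sq_nonneg ‖z - z'‖, sq_nonneg ‖v - v'‖]

theorem pairDist_nonneg {n m : ℕ} (z : Vec n) (v : Vec m) (z' : Vec n) (v' : Vec m) :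
    0 ≤ pairDist z v z' v' := Real.sqrt_nonneg _

namespace Data

variable {n m q : ℕ} (S : Data n m q)

/-! ### Concatenation of inputs -/

theorem traj_congr {v v' : ℕ → Vec m} (z : Vec n) {t : ℕ} (h : ∀ s < t, v s = v' s) :
    S.traj z v t = S.traj z v' t := by
  induction t with
  | zero => rfl
  | succ t ih =>
    simp only [traj]
    rw [ih fun s hs => h s (hs.trans t.lt_succ_self), h t t.lt_succ_self]

theorem traj_add (z : Vec n) (v : ℕ → Vec m) (P k : ℕ) :
    S.traj z v (P + k) = S.traj (S.traj z v P) (fun s => v (P + s)) k := by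
  induction k with
  | zero => rfl
  | succ k ih => rw [← add_assoc]; simp only [traj]; rw [ih]

theorem cost_add (ℓ : Vec n → Vec m → ℝ) (z : Vec n) (v : ℕ → Vec m) (P K : ℕ) :
    S.cost ℓ (P + K) z v =
      S.cost ℓ P z v + S.cost ℓ K (S.traj z v P) (fun s => v (P + s)) := by
  simp only [cost, Finset.sum_range_add, traj_add]

theorem Adm.of_le {z : Vec n} {v : ℕ → Vec m} {K P : ℕ} (h : S.Adm K z v) (hPK : P ≤ K) :
    S.Adm P z v := fun t ht => h t (ht.trans_le hPK)

theorem Adm.shift {z : Vec n} {v : ℕ → Vec m} {K P : ℕ} (h : S.Adm (P + K) z v) :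
    S.Adm K (S.traj z v P) (fun s => v (P + s)) := fun t ht => by
  rw [← traj_add]; exact h _ (by omega)

theorem Adm.append {z : Vec n} {v : ℕ → Vec m} {K P : ℕ} (h : S.Adm P z v)
    (h' : S.Adm K (S.traj z v P) (fun s => v (P + s))) : S.Adm (P + K) z v := fun t ht => by
  rcases lt_or_ge t P with htP | htP
  · exact h t htP
  · obtain ⟨k, rfl⟩ := Nat.exists_eq_add_of_le htP
    rw [traj_add]; exact h' k (by omega)

theorem exists_concat {z : Vec n} {v : ℕ → Vec m} {P : ℕ} (h : S.Adm P z v) (v' : ℕ → Vec m)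
    (ℓ : Vec n → Vec m → ℝ) :
    ∃ c, S.Adm P z c ∧ S.traj z c P = S.traj z v P ∧ S.cost ℓ P z c = S.cost ℓ P z v ∧
      (fun s => c (P + s)) = v' := by
  let c : ℕ → Vec m := fun t => if t < P then v t else v' (t - P)
  have hc : ∀ t < P, c t = v t := fun t ht => if_pos ht
  have ht : ∀ t ≤ P, S.traj z c t = S.traj z v t := fun t ht =>
    S.traj_congr z fun s hs => hc s (hs.trans_le ht)
  refine ⟨c, fun t htP => ?_, ht P le_rfl, Finset.sum_congr rfl fun t htP => ?_, ?_⟩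
  · rw [ht t htP.le, hc t htP]; exact h t htP
  · have := Finset.mem_range.1 htP
    rw [ht t this.le, hc t this]
  · funext s
    simp [c]

theorem xinf_of_reach {z : Vec n} {v : ℕ → Vec m} {P : ℕ} (h : S.Adm P z v)
    (hX : S.traj z v P ∈ S.Xinf) : z ∈ S.Xinf := by
  obtain ⟨v', hv'⟩ := hX
  obtain ⟨c, hc, hct, -, hcs⟩ := S.exists_concat h v' (fun _ _ => 0)
  refine ⟨c, fun t => ?_⟩
  refine Adm.append S (K := t + 1) hc ?_ t (by omega)
  rw [hct, hcs]
  exact fun s _ => hv' s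

theorem AdmInf.adm {z : Vec n} {v : ℕ → Vec m} (h : S.AdmInf z v) (K : ℕ) : S.Adm K z v :=
  fun t _ => h t

theorem AdmInf.shift {z : Vec n} {v : ℕ → Vec m} (h : S.AdmInf z v) (P : ℕ) :
    S.AdmInf (S.traj z v P) (fun s => v (P + s)) := fun t => by
  rw [← traj_add]; exact h _

theorem feasible_of_mem_Xinf {z : Vec n} (h : z ∈ S.Xinf) (K : ℕ) : ∃ v, S.Adm K z v := by
  obtain ⟨v, hv⟩ := h
  exact ⟨v, hv.adm S K⟩

/-! ### Optimal steady state problems -/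

/-- What the turnpike analysis uses about an optimal steady state: strict dissipativity with a
storage function bounded by `C`, cheap infinite horizon inputs with cost at most `D`, arbitrarily
cheap steering between states near the steady state, and chosen optimal inputs with continuity of
the optimal values at the steady state. -/
structure SteadyProblem (ℓ : Vec n → Vec m → ℝ) (zs : Vec n) (vs : Vec m) (lam : Vec n → ℝ)
    (αl αV : ℝ → ℝ) (M : ℕ) (vstar : ℕ → Vec n → ℕ → Vec m) (C D : ℝ) : Prop where
  αl_kinf : IsKInf αl
  αV_kinf : IsKInf αV
  lam_le : ∀ z, |lam z| ≤ C
  diss : ∀ z v, (z, v) ∈ S.Zbar → lam (S.fpi z v 0) - lam z ≤ ℓ z v - αl (pairDist z v zs vs)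
  cheap : ∀ z ∈ S.Xinf, ∃ v, S.AdmInf z v ∧ ∀ K, S.cost ℓ K z v ≤ D
  steady_mem : (zs, vs) ∈ S.Zbar
  steady_eq : S.fpi zs vs 0 = zs
  steady_cost : ℓ zs vs = 0
  steer : ∀ ε > 0, ∃ ρ > 0, ∀ y z : Vec n, ‖y - zs‖ ≤ ρ → ‖z - zs‖ ≤ ρ →
    ∃ v : ℕ → Vec m, S.traj y v M = z ∧ S.Adm M y v ∧ S.cost ℓ M y v ≤ ε
  opt : ∀ N z, (∃ v, S.Adm N z v) → S.IsOptimalInput ℓ N z (vstar N z)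
  value_cont : ∀ N : ℕ, ∀ z ∈ S.Xinf,
    S.cost ℓ N z (vstar N z) ≤ S.cost ℓ N zs (vstar N zs) + αV ‖z - zs‖ ∧
    S.cost ℓ N zs (vstar N zs) ≤ S.cost ℓ N z (vstar N z) + αV ‖z - zs‖

/-- The infinite horizon optimal value as a real number. -/
noncomputable def vinf (ℓ : Vec n → Vec m → ℝ) (z : Vec n) : ℝ := (S.Vinf ℓ z).toReal

theorem costInf_le_of_eventually_le {ℓ : Vec n → Vec m → ℝ} {z : Vec n} {v : ℕ → Vec m} {A : ℝ}
    (h : ∀ᶠ K in atTop, S.cost ℓ K z v ≤ A) : S.costInf ℓ z v ≤ (A : EReal) := by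
  refine Filter.limsup_le_of_le (by isBoundedDefault) ?_
  filter_upwards [h] with K hK
  exact_mod_cast hK

theorem Vinf_le_of_eventually_le {ℓ : Vec n → Vec m → ℝ} {z : Vec n} {v : ℕ → Vec m} {A : ℝ}
    (hv : S.AdmInf z v) (h : ∀ᶠ K in atTop, S.cost ℓ K z v ≤ A) : S.Vinf ℓ z ≤ (A : EReal) :=
  (iInf₂_le v hv).trans (S.costInf_le_of_eventually_le h)

theorem V_eq_of_isOptimalInput {ℓ : Vec n → Vec m → ℝ} {N : ℕ} {z : Vec n} {v : ℕ → Vec m}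
    (h : S.IsOptimalInput ℓ N z v) : S.V ℓ N z = (S.cost ℓ N z v : EReal) := by
  refine le_antisymm (iInf₂_le v h.1) (le_iInf₂ fun v' hv' => ?_)
  exact_mod_cast h.2 v' hv'

namespace SteadyProblem

variable {S} {ℓ : Vec n → Vec m → ℝ} {zs : Vec n} {vs : Vec m} {lam : Vec n → ℝ}
  {αl αV : ℝ → ℝ} {M : ℕ} {vstar : ℕ → Vec n → ℕ → Vec m} {C D : ℝ}
  (h : SteadyProblem S ℓ zs vs lam αl αV M vstar C D)
include h

theorem traj_steady (t : ℕ) : S.traj zs (fun _ => vs) t = zs := by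
  induction t with
  | zero => rfl
  | succ t ih => rw [traj, ih, h.steady_eq]

theorem admInf_steady : S.AdmInf zs (fun _ => vs) := fun t => by
  rw [h.traj_steady]; exact h.steady_mem

theorem cost_steady (K : ℕ) : S.cost ℓ K zs (fun _ => vs) = 0 := by
  simp [cost, h.traj_steady, h.steady_cost]

theorem steady_mem_Xinf : zs ∈ S.Xinf := ⟨_, h.admInf_steady⟩

/-- Such states can be steered to `zs` and then rest there, so any admissible trajectory that enters
this ball extends forever. -/
theorem exists_near_subset_Xinf : ∃ ρ > 0, ∀ z, ‖z - zs‖ ≤ ρ → z ∈ S.Xinf := by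
  obtain ⟨ρ, hρ, H⟩ := h.steer 1 one_pos
  refine ⟨ρ, hρ, fun z hz => ?_⟩
  obtain ⟨v, hv, hadm, -⟩ := H z zs hz (by simpa using hρ.le)
  exact S.xinf_of_reach hadm (hv ▸ h.steady_mem_Xinf)

theorem sum_le_cost {K : ℕ} {z : Vec n} {v : ℕ → Vec m} (hv : S.Adm K z v) :
    lam (S.traj z v K) - lam z +
      ∑ t ∈ Finset.range K, αl (pairDist (S.traj z v t) (v t) zs vs) ≤ S.cost ℓ K z v := by
  have h1 : lam (S.traj z v K) - lam z =
      ∑ t ∈ Finset.range K, (lam (S.traj z v (t + 1)) - lam (S.traj z v t)) := by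
    rw [Finset.sum_range_sub (fun t => lam (S.traj z v t))]; rfl
  rw [h1, ← Finset.sum_add_distrib]
  refine Finset.sum_le_sum fun t ht => ?_
  have := h.diss _ _ (hv t (Finset.mem_range.1 ht))
  simp only [traj]
  linarith

theorem αl_nonneg (z : Vec n) (v : Vec m) : 0 ≤ αl (pairDist z v zs vs) :=
  h.αl_kinf.1.nonneg (pairDist_nonneg _ _ _ _)

theorem lam_sub_le_cost {K : ℕ} {z : Vec n} {v : ℕ → Vec m} (hv : S.Adm K z v) :
    lam (S.traj z v K) - lam z ≤ S.cost ℓ K z v := by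
  have := h.sum_le_cost hv
  have h2 : 0 ≤ ∑ t ∈ Finset.range K, αl (pairDist (S.traj z v t) (v t) zs vs) :=
    Finset.sum_nonneg fun t _ => h.αl_nonneg _ _
  linarith

theorem neg_le_cost {K : ℕ} {z : Vec n} {v : ℕ → Vec m} (hv : S.Adm K z v) :
    -(2 * C) ≤ S.cost ℓ K z v := by
  have h1 := h.lam_sub_le_cost hv
  have h2 := abs_le.1 (h.lam_le (S.traj z v K))
  have h3 := abs_le.1 (h.lam_le z)
  linarith

/-- Turnpike property: an admissible trajectory of bounded cost that is long enough comes close to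
the steady state at an early time. -/
theorem exists_turnpike (A : ℝ) {σ : ℝ} (hσ : 0 < σ) :
    ∃ P₀ : ℕ, ∀ K > P₀, ∀ z v, S.Adm K z v → S.cost ℓ K z v ≤ A →
      ∃ P, 1 ≤ P ∧ P ≤ P₀ ∧ ‖S.traj z v P - zs‖ ≤ σ := by
  have hα := h.αl_kinf.1.pos hσ
  -- Staying outside the `σ`-ball at all times `1, …, P₀` would cost more than `A`. Counting starts
  -- at time one so that a first step can always be split off.
  obtain ⟨P₀, hP₀⟩ := exists_nat_gt ((A + 2 * C) / αl σ)
  rw [div_lt_iff₀ hα] at hP₀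
  refine ⟨P₀, fun K hK z v hv hcost => ?_⟩
  by_contra hcon
  push Not at hcon
  have h1 := h.sum_le_cost hv
  have h2 : (P₀ : ℝ) * αl σ ≤
      ∑ t ∈ Finset.range K, αl (pairDist (S.traj z v t) (v t) zs vs) := calc
    (P₀ : ℝ) * αl σ = ∑ t ∈ Finset.Icc 1 P₀, αl σ := by simp
    _ ≤ ∑ t ∈ Finset.Icc 1 P₀, αl (pairDist (S.traj z v t) (v t) zs vs) := by
      refine Finset.sum_le_sum fun t ht => ?_
      obtain ⟨ht1, ht2⟩ := Finset.mem_Icc.1 ht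
      exact h.αl_kinf.1.mono hσ.le ((hcon t ht1 ht2).le.trans (le_pairDist _ _ _ _).1)
    _ ≤ _ := by
      refine Finset.sum_le_sum_of_subset_of_nonneg (fun t ht => ?_) fun t _ _ =>
        h.αl_nonneg _ _
      have := (Finset.mem_Icc.1 ht).2
      exact Finset.mem_range.2 (by omega)
  have h3 := abs_le.1 (h.lam_le (S.traj z v K))
  have h4 := abs_le.1 (h.lam_le z)
  linarith

/-! ### Finite horizon values -/

theorem optCost_le {N : ℕ} {z : Vec n} {v : ℕ → Vec m} (hv : S.Adm N z v) :
    S.cost ℓ N z (vstar N z) ≤ S.cost ℓ N z v := (h.opt N z ⟨v, hv⟩).2 v hv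

theorem optCost_le_bound {z : Vec n} (hz : z ∈ S.Xinf) (N : ℕ) :
    S.cost ℓ N z (vstar N z) ≤ D := by
  obtain ⟨v, hv, hD⟩ := h.cheap z hz
  exact (h.optCost_le (hv.adm S N)).trans (hD N)

/-- Upper half of dynamic programming, for an arbitrary prefix; `add_le_cost` is the lower half. -/
theorem optCost_le_add {P K : ℕ} {z : Vec n} {v : ℕ → Vec m} (hv : S.Adm P z v)
    (hK : ∃ v', S.Adm K (S.traj z v P) v') :
    S.cost ℓ (P + K) z (vstar (P + K) z) ≤
      S.cost ℓ P z v + S.cost ℓ K (S.traj z v P) (vstar K (S.traj z v P)) := by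
  obtain ⟨c, hc, hct, hcc, hcs⟩ := S.exists_concat hv (vstar K (S.traj z v P)) ℓ
  have hadm : S.Adm (P + K) z c := hc.append S (by rw [hct, hcs]; exact (h.opt _ _ hK).1)
  have := h.optCost_le hadm
  rwa [S.cost_add ℓ z c, hct, hcs, hcc] at this

theorem add_le_cost {P K : ℕ} {z : Vec n} {v : ℕ → Vec m} (hv : S.Adm (P + K) z v) :
    S.cost ℓ P z v + S.cost ℓ K (S.traj z v P) (vstar K (S.traj z v P)) ≤
      S.cost ℓ (P + K) z v := by
  rw [cost_add]
  have := h.optCost_le (hv.shift S)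
  linarith

/-- Waiting `P` steps at the steady state is admissible and free. -/
theorem optCost_steady_le (P K : ℕ) :
    S.cost ℓ (P + K) zs (vstar (P + K) zs) ≤ S.cost ℓ K zs (vstar K zs) := by
  have := h.optCost_le_add (P := P) (K := K) (h.admInf_steady.adm S P)
    (by rw [h.traj_steady]; exact S.feasible_of_mem_Xinf h.steady_mem_Xinf K)
  rwa [h.cost_steady, h.traj_steady, zero_add] at this

/-- The optimal values of the steady state are nearly constant for large horizons. -/
theorem eventually_optCost_steady_sub_le (P₀ : ℕ) {ε : ℝ} (hε : 0 < ε) :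
    ∀ᶠ N : ℕ in atTop, ∀ P ≤ P₀, ∀ K, P + K = N →
      S.cost ℓ K zs (vstar K zs) ≤ S.cost ℓ N zs (vstar N zs) + ε := by
  set U : ℕ → ℝ := fun K => S.cost ℓ K zs (vstar K zs) with hU
  -- Being monotone and bounded below, `U` converges to its infimum, which lies below every `U N`.
  have hanti : Antitone U := by
    refine antitone_nat_of_succ_le fun K => ?_
    have := h.optCost_steady_le 1 K
    rwa [add_comm 1 K] at this
  have hbdd : BddBelow (Set.range U) := ⟨-(2 * C), by
    rintro _ ⟨K, rfl⟩
    exact h.neg_le_cost (h.opt _ _ (S.feasible_of_mem_Xinf h.steady_mem_Xinf K)).1⟩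
  have hlim := tendsto_atTop_ciInf hanti hbdd
  obtain ⟨K₀, hK₀⟩ := eventually_atTop.1 (hlim.eventually_lt_const (lt_add_of_pos_right _ hε))
  filter_upwards [eventually_ge_atTop (P₀ + K₀)] with N hN P hP K hK
  have h1 := hK₀ K (by omega)
  have h2 : ⨅ i, U i ≤ U N := ciInf_le hbdd N
  change U K ≤ U N + ε
  linarith

/-! ### The infinite horizon value -/

theorem neg_le_costInf {z : Vec n} {v : ℕ → Vec m} (hv : S.AdmInf z v) :
    ((-(2 * C) : ℝ) : EReal) ≤ S.costInf ℓ z v := by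
  refine Filter.le_limsup_of_frequently_le (Eventually.frequently ?_) (by isBoundedDefault)
  filter_upwards with K
  exact_mod_cast h.neg_le_cost (hv.adm S K)

theorem Vinf_le_bound {z : Vec n} (hz : z ∈ S.Xinf) : S.Vinf ℓ z ≤ (D : EReal) := by
  obtain ⟨v, hv, hD⟩ := h.cheap z hz
  exact S.Vinf_le_of_eventually_le hv (Eventually.of_forall hD)

theorem neg_le_Vinf (z : Vec n) : ((-(2 * C) : ℝ) : EReal) ≤ S.Vinf ℓ z :=
  le_iInf₂ fun _ hv => h.neg_le_costInf hv

theorem coe_vinf {z : Vec n} (hz : z ∈ S.Xinf) : (S.vinf ℓ z : EReal) = S.Vinf ℓ z := by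
  refine EReal.coe_toReal (ne_top_of_le_ne_top (EReal.coe_ne_top D) (h.Vinf_le_bound hz))
    (ne_bot_of_le_ne_bot (EReal.coe_ne_bot (-(2 * C))) (h.neg_le_Vinf z))

theorem vinf_le_bound {z : Vec n} (hz : z ∈ S.Xinf) : S.vinf ℓ z ≤ D := by
  have := h.Vinf_le_bound hz
  rw [← h.coe_vinf hz] at this
  exact_mod_cast this

theorem neg_le_vinf {z : Vec n} (hz : z ∈ S.Xinf) : -(2 * C) ≤ S.vinf ℓ z := by
  have := h.neg_le_Vinf z
  rw [← h.coe_vinf hz] at this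
  exact_mod_cast this

theorem vinf_le_of_eventually_le {z : Vec n} {v : ℕ → Vec m} {A : ℝ}
    (hv : S.AdmInf z v) (hA : ∀ᶠ K in atTop, S.cost ℓ K z v ≤ A) : S.vinf ℓ z ≤ A := by
  have := S.Vinf_le_of_eventually_le hv hA
  rw [← h.coe_vinf ⟨v, hv⟩] at this
  exact_mod_cast this

/-- Infinite-horizon minimisers are not assumed to exist. Nearly optimal inputs replace them, with
the limsup unfolded into a bound on all late partial costs. -/
theorem exists_nearly_optimal {z : Vec n} (hz : z ∈ S.Xinf) {η : ℝ} (hη : 0 < η) :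
    ∃ v, S.AdmInf z v ∧ ∀ᶠ K in atTop, S.cost ℓ K z v ≤ S.vinf ℓ z + η := by
  have hlt : S.Vinf ℓ z < ((S.vinf ℓ z + η : ℝ) : EReal) := by
    rw [← h.coe_vinf hz]
    exact_mod_cast lt_add_of_pos_right _ hη
  obtain ⟨v, hv⟩ := iInf_lt_iff.1 hlt
  obtain ⟨hadm, hv⟩ := iInf_lt_iff.1 hv
  refine ⟨v, hadm, ?_⟩
  filter_upwards [Filter.eventually_lt_of_limsup_lt hv (by isBoundedDefault)] with K hK
  exact le_of_lt (by exact_mod_cast hK)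

theorem vinf_le_add {P : ℕ} {z : Vec n} {v : ℕ → Vec m} (hv : S.Adm P z v)
    (hX : S.traj z v P ∈ S.Xinf) :
    S.vinf ℓ z ≤ S.cost ℓ P z v + S.vinf ℓ (S.traj z v P) := by
  refine le_of_forall_pos_le_add fun η hη => ?_
  obtain ⟨v', hv', hK⟩ := h.exists_nearly_optimal hX hη
  obtain ⟨c, hc, hct, hcc, hcs⟩ := S.exists_concat hv v' ℓ
  have hadm : ∀ K, S.Adm (P + K) z c := fun K =>
    hc.append S (by rw [hct, hcs]; exact hv'.adm S K)
  refine h.vinf_le_of_eventually_le (v := c) (fun t => hadm (t + 1) t (by omega)) ?_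
  obtain ⟨K₀, hK₀⟩ := eventually_atTop.1 hK
  filter_upwards [eventually_ge_atTop (P + K₀)] with K hKK
  obtain ⟨k, rfl⟩ := Nat.exists_eq_add_of_le (show P ≤ K by omega)
  rw [cost_add, hct, hcs, hcc]
  linarith [hK₀ k (by omega)]

theorem add_vinf_le {P : ℕ} {z : Vec n} {v : ℕ → Vec m} {A : ℝ} (hv : S.AdmInf z v)
    (hA : ∀ᶠ K in atTop, S.cost ℓ K z v ≤ A) :
    S.cost ℓ P z v + S.vinf ℓ (S.traj z v P) ≤ A := by
  obtain ⟨K₀, hK₀⟩ := eventually_atTop.1 hA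
  have := h.vinf_le_of_eventually_le (A := A - S.cost ℓ P z v) (hv.shift S P) (by
    filter_upwards [eventually_ge_atTop K₀] with K hK
    have := hK₀ (P + K) (by omega)
    rw [cost_add] at this
    linarith)
  linarith

end SteadyProblem

theorem traj_succ_eq (z : Vec n) (v : ℕ → Vec m) (P : ℕ) :
    S.traj (S.fpi z (v 0) 0) (fun s => v (1 + s)) P = S.traj z v (P + 1) := by
  rw [add_comm P 1, traj_add]; rfl

namespace SteadyProblem

variable {S} {ℓ : Vec n → Vec m → ℝ} {zs : Vec n} {vs : Vec m} {lam : Vec n → ℝ}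
  {αl αV : ℝ → ℝ} {M : ℕ} {vstar : ℕ → Vec n → ℕ → Vec m} {C D : ℝ}
  (h : SteadyProblem S ℓ zs vs lam αl αV M vstar C D)
include h

/-! ### Continuity at the steady state -/

/-- `lam` is not assumed continuous. Its continuity at `zs` follows from dissipation along cheap
steering to and from `zs`. -/
theorem exists_lam_near {ε : ℝ} (hε : 0 < ε) :
    ∃ ρ > 0, ∀ z, ‖z - zs‖ ≤ ρ → |lam z - lam zs| ≤ ε := by
  obtain ⟨ρ, hρ, H⟩ := h.steer ε hε
  refine ⟨ρ, hρ, fun z hz => abs_le.2 ?_⟩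
  have hzs : ‖zs - zs‖ ≤ ρ := by simpa using hρ.le
  obtain ⟨v, hv, hadm, hc⟩ := H z zs hz hzs
  obtain ⟨v', hv', hadm', hc'⟩ := H zs z hzs hz
  have h1 := h.lam_sub_le_cost hadm
  have h2 := h.lam_sub_le_cost hadm'
  rw [hv] at h1
  rw [hv'] at h2
  constructor <;> linarith

/-- Cheap steering in both directions, now combined with dynamic programming for `V_∞`. -/
theorem exists_vinf_near {ε : ℝ} (hε : 0 < ε) :
    ∃ ρ > 0, ∀ z, ‖z - zs‖ ≤ ρ → z ∈ S.Xinf ∧ |S.vinf ℓ z - S.vinf ℓ zs| ≤ ε := by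
  obtain ⟨ρ, hρ, H⟩ := h.steer ε hε
  obtain ⟨ρ', hρ', H'⟩ := h.exists_near_subset_Xinf
  refine ⟨min ρ ρ', lt_min hρ hρ', fun z hz => ?_⟩
  have hzX := H' z (hz.trans (min_le_right _ _))
  have hz := hz.trans (min_le_left _ _)
  refine ⟨hzX, abs_le.2 ?_⟩
  have hzs : ‖zs - zs‖ ≤ ρ := by simpa using hρ.le
  obtain ⟨v, hv, hadm, hc⟩ := H z zs hz hzs
  obtain ⟨v', hv', hadm', hc'⟩ := H zs z hzs hz
  have h1 := h.vinf_le_add hadm (hv ▸ h.steady_mem_Xinf)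
  have h2 := h.vinf_le_add hadm' (hv' ▸ hzX)
  rw [hv] at h1
  rw [hv'] at h2
  constructor <;> linarith

/-! ### Turnpike estimates for optimal trajectories -/

/-- The cost bound is the hypothesis, rather than `z ∈ 𝕏_∞`, because the result is also applied to
tube minimisers not yet known to lie in `𝕏_∞`. -/
theorem exists_optimal_turnpike {σ : ℝ} (hσ : 0 < σ) :
    ∃ P₀ : ℕ, ∀ N > P₀, ∀ z, (∃ v, S.Adm N z v) → S.cost ℓ N z (vstar N z) ≤ D →
      ∃ P K, P + 1 ≤ P₀ ∧ P + 1 + K = N ∧ S.Adm N z (vstar N z) ∧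
        S.traj z (vstar N z) (P + 1) ∈ S.Xinf ∧ ‖S.traj z (vstar N z) (P + 1) - zs‖ ≤ σ := by
  obtain ⟨ρ, hρ, H⟩ := h.exists_near_subset_Xinf
  obtain ⟨P₀, hP₀⟩ := h.exists_turnpike D (lt_min hσ hρ)
  refine ⟨P₀, fun N hN z hz hD => ?_⟩
  obtain ⟨P, hP1, hP2, hP⟩ := hP₀ N hN z _ (h.opt N z hz).1 hD
  obtain ⟨P, rfl⟩ := Nat.exists_eq_add_of_le' hP1
  exact ⟨P, N - (P + 1), hP2, by omega, (h.opt N z hz).1, H _ (hP.trans (min_le_right _ _)),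
    hP.trans (min_le_left _ _)⟩

/-- The optimal trajectory enters `𝕏_∞` at some time at least one, so its initial state and its
first successor both reach `𝕏_∞`. -/
theorem eventually_mem_Xinf :
    ∀ᶠ N in atTop, ∀ z, (∃ v, S.Adm N z v) → S.cost ℓ N z (vstar N z) ≤ D →
      z ∈ S.Xinf ∧ S.fpi z (vstar N z 0) 0 ∈ S.Xinf := by
  obtain ⟨P₀, hP₀⟩ := h.exists_optimal_turnpike one_pos
  filter_upwards [eventually_gt_atTop P₀] with N hN z hz hD
  obtain ⟨P, K, -, hPK, hadm, hX, -⟩ := hP₀ N hN z hz hD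
  have hadm' : S.Adm (1 + P) z (vstar N z) := hadm.of_le S (by omega)
  refine ⟨S.xinf_of_reach hadm' (by rwa [add_comm 1 P]), ?_⟩
  refine S.xinf_of_reach (z := S.fpi z (vstar N z 0) 0) (hadm'.shift S) ?_
  rwa [traj_succ_eq]

/-- From the successor, follow the old optimal trajectory to its passage near `zs`, then use a tail
one step longer. Comparing both tails through `zs` costs at most `2 αV(σ)`, and the longer horizon
is no more expensive at `zs`. -/
theorem eventually_optCost_succ_le {ε : ℝ} (hε : 0 < ε) :
    ∀ᶠ N in atTop, ∀ z ∈ S.Xinf,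
      S.cost ℓ N (S.fpi z (vstar N z 0) 0) (vstar N (S.fpi z (vstar N z 0) 0)) ≤
        S.cost ℓ N z (vstar N z) - ℓ z (vstar N z 0) + ε := by
  obtain ⟨σ, hσ, hα⟩ := h.αV_kinf.1.exists_pos_le (half_pos hε)
  obtain ⟨P₀, hP₀⟩ := h.exists_optimal_turnpike hσ
  filter_upwards [eventually_gt_atTop P₀] with N hN z hz
  obtain ⟨P, K, -, hPK, hadm, hX, hnear⟩ := hP₀ N hN z (S.feasible_of_mem_Xinf hz N)
    (h.optCost_le_bound hz N)
  set v := vstar N z with hv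
  have hadm' : S.Adm (1 + P) z v := hadm.of_le S (by omega)
  have h1 : S.cost ℓ (P + 1) z v + S.cost ℓ K (S.traj z v (P + 1))
      (vstar K (S.traj z v (P + 1))) ≤ S.cost ℓ N z v := by
    have := h.add_le_cost (P := P + 1) (K := K) (by rwa [hPK])
    rwa [hPK] at this
  have h2 : S.cost ℓ (1 + P) z v = S.cost ℓ 1 z v + _ := S.cost_add ℓ z v 1 P
  have h2' : S.cost ℓ 1 z v = ℓ z (v 0) := by simp [cost, traj]
  have ht : S.traj z v 1 = S.fpi z (v 0) 0 := rfl
  rw [ht, h2', add_comm 1 P] at h2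
  have h3 := h.optCost_le_add (P := P) (K := K + 1) (z := S.fpi z (v 0) 0)
    (v := fun s => v (1 + s)) (hadm'.shift S)
    (by rw [traj_succ_eq]; exact S.feasible_of_mem_Xinf hX _)
  rw [traj_succ_eq, show P + (K + 1) = N by omega] at h3
  have h4 := (h.value_cont (K + 1) _ hX).1
  have h5 := (h.value_cont K _ hX).2
  have h6 := h.optCost_steady_le 1 K
  rw [add_comm 1 K] at h6
  have h7 := hα _ (norm_nonneg _) hnear
  linarith

/-- Up to the passage near `zs`, dissipation pays the change of `lam` plus the initial term `αl`;
afterwards the tail value is nearly `V_K(zs) ≥ V_N(zs)`. -/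
theorem eventually_storage_lower_bound {ε : ℝ} (hε : 0 < ε) :
    ∀ᶠ N in atTop, ∀ z ∈ S.Xinf,
      S.cost ℓ N zs (vstar N zs) + lam zs + αl ‖z - zs‖ ≤
        S.cost ℓ N z (vstar N z) + lam z + ε := by
  obtain ⟨σ, hσ, hα⟩ := h.αV_kinf.1.exists_pos_le (half_pos hε)
  obtain ⟨ρ, hρ, hlam⟩ := h.exists_lam_near (half_pos hε)
  obtain ⟨P₀, hP₀⟩ := h.exists_optimal_turnpike (lt_min hσ hρ)
  filter_upwards [eventually_gt_atTop P₀] with N hN z hz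
  obtain ⟨P, K, -, hPK, hadm, hX, hnear⟩ := hP₀ N hN z (S.feasible_of_mem_Xinf hz N)
    (h.optCost_le_bound hz N)
  set v := vstar N z with hv
  have h1 : S.cost ℓ (P + 1) z v + S.cost ℓ K (S.traj z v (P + 1))
      (vstar K (S.traj z v (P + 1))) ≤ S.cost ℓ N z v := by
    have := h.add_le_cost (P := P + 1) (K := K) (by rwa [hPK])
    rwa [hPK] at this
  have h2 := h.sum_le_cost (hadm.of_le S (show P + 1 ≤ N by omega))
  have h3 : αl ‖z - zs‖ ≤
      ∑ t ∈ Finset.range (P + 1), αl (pairDist (S.traj z v t) (v t) zs vs) := by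
    have h31 := Finset.single_le_sum
      (f := fun t => αl (pairDist (S.traj z v t) (v t) zs vs)) (s := Finset.range (P + 1)) (a := 0)
      (fun t _ => h.αl_nonneg _ _) (Finset.mem_range.2 P.succ_pos)
    exact (h.αl_kinf.1.mono (norm_nonneg _) (le_pairDist z (v 0) zs vs).1).trans h31
  have h5 := (h.value_cont K _ hX).2
  have h6 := h.optCost_steady_le (P + 1) K
  rw [hPK] at h6
  have h7 := hα _ (norm_nonneg _) (hnear.trans (min_le_left _ _))
  have h8 := abs_le.1 (hlam _ (hnear.trans (min_le_right _ _)))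
  linarith

/-- Up to constants, finite and infinite horizon values agree for large horizons. -/
theorem eventually_optCost_sub_vinf_le {ε : ℝ} (hε : 0 < ε) :
    ∀ᶠ N in atTop, ∀ z ∈ S.Xinf,
      |(S.cost ℓ N z (vstar N z) - S.cost ℓ N zs (vstar N zs)) -
        (S.vinf ℓ z - S.vinf ℓ zs)| ≤ ε := by
  have hε4 : 0 < ε / 4 := by positivity
  obtain ⟨σ, hσ, hα⟩ := h.αV_kinf.1.exists_pos_le hε4
  obtain ⟨ρ, hρ, hvinf⟩ := h.exists_vinf_near hε4
  obtain ⟨P₀, hP₀⟩ := h.exists_optimal_turnpike (lt_min hσ hρ)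
  obtain ⟨P₁, hP₁⟩ := h.exists_turnpike (D + ε / 4) (lt_min hσ hρ)
  filter_upwards [eventually_gt_atTop P₀, eventually_gt_atTop P₁,
    h.eventually_optCost_steady_sub_le P₁ hε4] with N hN hN₁ hsteady z hz
  refine abs_le.2 ⟨?_, ?_⟩
  -- Lower bound: the prefix of the finite-horizon optimum is completed by the value `V_∞` at the
  -- cut.
  · obtain ⟨P, K, -, hPK, hadm, hX, hnear⟩ := hP₀ N hN z (S.feasible_of_mem_Xinf hz N)
      (h.optCost_le_bound hz N)
    set v := vstar N z with hv
    have h1 : S.cost ℓ (P + 1) z v + S.cost ℓ K (S.traj z v (P + 1))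
        (vstar K (S.traj z v (P + 1))) ≤ S.cost ℓ N z v := by
      have := h.add_le_cost (P := P + 1) (K := K) (by rwa [hPK])
      rwa [hPK] at this
    have h2 := h.vinf_le_add (hadm.of_le S (show P + 1 ≤ N by omega)) hX
    have h3 := abs_le.1 (hvinf _ (hnear.trans (min_le_right _ _))).2
    have h5 := (h.value_cont K _ hX).2
    have h6 := h.optCost_steady_le (P + 1) K
    rw [hPK] at h6
    have h7 := hα _ (norm_nonneg _) (hnear.trans (min_le_left _ _))
    linarith
  -- Upper bound: the prefix comes from a nearly optimal infinite input. The auxiliary horizon `K'`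
  -- only serves to locate its passage near `zs`; this direction needs `V_K(zs)` to be nearly
  -- constant in `K`.
  · obtain ⟨v, hadm, hcost⟩ := h.exists_nearly_optimal hz hε4
    obtain ⟨K', hK', hcK'⟩ := ((eventually_gt_atTop P₁).and hcost).exists
    have hle := h.vinf_le_bound hz
    obtain ⟨P, hP1, hP2, hnear⟩ := hP₁ K' hK' z v (hadm.adm S K') (by linarith)
    obtain ⟨K, rfl⟩ := Nat.exists_eq_add_of_le (show P ≤ N by omega)
    have hnear2 := hvinf _ (hnear.trans (min_le_right _ _))
    have h1 := h.optCost_le_add (P := P) (K := K) (hadm.adm S P)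
      (S.feasible_of_mem_Xinf hnear2.1 K)
    have h2 := h.add_vinf_le (P := P) hadm hcost
    have h3 := abs_le.1 hnear2.2
    have h5 := (h.value_cont K _ hnear2.1).1
    have h6 := hsteady P hP2 K rfl
    have h7 := hα _ (norm_nonneg _) (hnear.trans (min_le_left _ _))
    linarith

/-! ### The tube problem -/

variable {zstar : ℕ → Vec n → Vec n}
  (hz : ∀ N x, S.TubeFeasible N x → S.IsOptimalTubeState ℓ N x (zstar N x))
include hz

theorem optCost_zstar_le {N : ℕ} {x z : Vec n} (hzX : z ∈ S.Xinf) (hx : x - z ∈ S.Ω) :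
    S.cost ℓ N (zstar N x) (vstar N (zstar N x)) ≤ S.cost ℓ N z (vstar N z) := by
  have hfeas := S.feasible_of_mem_Xinf hzX N
  obtain ⟨-, hv, hopt⟩ := hz N x ⟨z, hx, hfeas⟩
  have := hopt z hx
  rw [S.V_eq_of_isOptimalInput (h.opt _ _ hv), S.V_eq_of_isOptimalInput (h.opt _ _ hfeas)] at this
  exact_mod_cast this

/-- The minimiser costs no more than the given competitor in `𝕏_∞`, hence at most `D`, and
`eventually_mem_Xinf` applies to it. -/
theorem eventually_wellPosedAt :
    ∀ᶠ N in atTop, ∀ x, (∃ z ∈ S.Xinf, x - z ∈ S.Ω) → S.WellPosedAt zstar N x := by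
  filter_upwards [h.eventually_mem_Xinf] with N hN x ⟨z, hzX, hx⟩
  have hf : S.TubeFeasible N x := ⟨z, hx, S.feasible_of_mem_Xinf hzX N⟩
  exact ⟨hf, (hN _ (hz N x hf).2.1
    ((h.optCost_zstar_le hz hzX hx).trans (h.optCost_le_bound hzX N))).1⟩

/-- The nominal successor is itself a candidate in the tube problem at the next state, so choosing
`zstar` preserves the decrease. -/
theorem eventually_Zcl_step {ε : ℝ} (hε : 0 < ε) :
    ∀ᶠ N in atTop, ∀ z ∈ S.Xinf, ∀ z' ∈ S.Zcl vstar zstar N z, z' ∈ S.Xinf ∧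
      S.cost ℓ N z' (vstar N z') ≤ S.cost ℓ N z (vstar N z) - ℓ z (vstar N z 0) + ε := by
  filter_upwards [h.eventually_mem_Xinf, h.eventually_wellPosedAt hz,
    h.eventually_optCost_succ_le hε] with N hN hwp hsucc z hzX z' ⟨x, hx, hf, hz'⟩
  subst hz'
  have hX := (hN z (S.feasible_of_mem_Xinf hzX N) (h.optCost_le_bound hzX N)).2
  exact ⟨(hwp x ⟨_, hX, hx⟩).2, (h.optCost_zstar_le hz hX hx).trans (hsucc z hzX)⟩

/-- The offset `V_N(zs) - V_∞(zs)` cancels in the difference of two values. -/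
theorem eventually_stage_cost_le {ε : ℝ} (hε : 0 < ε) :
    ∀ᶠ N in atTop, ∀ z ∈ S.Xinf, ∀ z' ∈ S.Zcl vstar zstar N z,
      ℓ z (vstar N z 0) ≤ S.vinf ℓ z - S.vinf ℓ z' + ε := by
  have hε3 : 0 < ε / 3 := by positivity
  filter_upwards [h.eventually_Zcl_step hz hε3, h.eventually_optCost_sub_vinf_le hε3]
    with N hN hv z hzX z' hz'
  obtain ⟨hX, hle⟩ := hN z hzX z' hz'
  have h1 := abs_le.1 (hv z hzX)
  have h2 := abs_le.1 (hv z' hX)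
  linarith

/-- Practical convergence of the closed-loop nominal states. -/
theorem exists_practicallyConvergent
    (hcl : S.ClosedLoopDissipative ℓ zs vs lam αl vstar zstar) :
    ∃ β ε₁, S.PracticallyConvergent zs vstar zstar β ε₁ := by
  obtain ⟨b, hb, hlamb⟩ := exists_isKInf_ge (fun z : Vec n => ‖z - zs‖)
    (fun z => lam z - lam zs) (fun z => norm_nonneg _) (C := 2 * C)
    (fun z => by linarith [(abs_le.1 (h.lam_le z)).2, (abs_le.1 (h.lam_le zs)).1])
    (fun ε hε => by
      obtain ⟨ρ, hρ, H⟩ := h.exists_lam_near hε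
      exact ⟨ρ, hρ, fun z hz => (abs_le.1 (H z hz)).2⟩)
  obtain ⟨β, χ, hβ, hχ, H⟩ := exists_practical_bound h.αl_kinf (h.αV_kinf.add hb)
  let P : ℕ → ℝ → Prop := fun N ε => ∀ z : ℕ → Vec n, z 0 ∈ S.Xinf →
    (∀ t, z (t + 1) ∈ S.Zcl vstar zstar N (z t)) →
    ∀ t : ℕ, ‖z t - zs‖ ≤ max (β ‖z 0 - zs‖ t) ε
  have hP : ∀ ε > 0, ∀ᶠ N in atTop, P N ε := by
    intro ε hε
    obtain ⟨d, hd, hχd⟩ := hχ.1.exists_pos_le hε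
    filter_upwards [h.eventually_Zcl_step hz hd, h.eventually_storage_lower_bound hd,
      eventually_ge_atTop 1] with N hstepN hlowN hN1 z h0 hstep t
    have hX : ∀ t, z t ∈ S.Xinf := by
      intro t
      induction t with
      | zero => exact h0
      | succ t ih => exact (hstepN _ ih _ (hstep t)).1
    -- The Lyapunov function is the rotated value relative to `zs`, shifted by `d` to dominate `αl`.
    -- In its decrease, the stage cost lost by `V_N` cancels the one gained by `lam` in the
    -- closed-loop dissipation inequality.
    refine (H (fun t => ‖z t - zs‖) (fun t => S.cost ℓ N (z t) (vstar N (z t)) + lam (z t) -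
      S.cost ℓ N zs (vstar N zs) - lam zs + d) d hd.le (fun t => norm_nonneg _)
      (fun t => by linarith [hlowN _ (hX t)]) (fun t => ?_) (fun t => ?_) t).trans
      (max_le_max le_rfl (hχd d hd.le le_rfl))
    · have h1 := (h.value_cont N _ (hX t)).1
      have h2 := hlamb (z t)
      linarith
    · have h1 := (hstepN _ (hX t) _ (hstep t)).2
      have h2 := hcl N hN1 _ (hX t) _ (hstep t)
      have h3 := h.αl_kinf.1.mono (norm_nonneg _)
        (le_pairDist (z t) (vstar N (z t) 0) zs vs).1
      rw [h.steady_cost, sub_zero] at h2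
      linarith
  obtain ⟨δ, hδ, Hδ⟩ := exists_isL (P := P)
    (fun N a b hab hP z h0 hstep t => (hP z h0 hstep t).trans (max_le_max le_rfl hab)) hP
  refine ⟨β, δ, hβ, hδ, ?_⟩
  filter_upwards [hP 1 one_pos] with N hN using Hδ N ⟨1, hN⟩

end SteadyProblem

/-! ### Closed loops -/

theorem sub_fpi_mem_of_isClosedLoop {ℓ : Vec n → Vec m → ℝ} {vstar : ℕ → Vec n → ℕ → Vec m}
    {zstar : ℕ → Vec n → Vec n} (hrci : S.IsRCI)
    (hv : ∀ N z, (∃ v, S.Adm N z v) → S.IsOptimalInput ℓ N z (vstar N z))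
    (hz : ∀ N x, S.TubeFeasible N x → S.IsOptimalTubeState ℓ N x (zstar N x))
    {N : ℕ} (hN : 1 ≤ N) {x : ℕ → Vec n} {w : ℕ → Vec q} (hcl : S.IsClosedLoop vstar zstar N x w)
    {t : ℕ} (hf : S.TubeFeasible N (x t)) :
    (zstar N (x t), vstar N (zstar N (x t)) 0) ∈ S.Zbar ∧ x t - zstar N (x t) ∈ S.Ω ∧
      x (t + 1) - S.fpi (zstar N (x t)) (vstar N (zstar N (x t)) 0) 0 ∈ S.Ω := by
  obtain ⟨hΩ, hadm, -⟩ := hz N _ hf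
  have hbar : (zstar N (x t), vstar N (zstar N (x t)) 0) ∈ S.Zbar := (hv N _ hadm).1 0 hN
  refine ⟨hbar, hΩ, ?_⟩
  rw [(hcl t).2]
  refine hrci.2 _ _ _ _ hΩ ?_ (hcl t).1
  have := hbar _ hΩ
  rwa [add_sub_cancel] at this

theorem mem_Zcl_of_isClosedLoop {ℓ : Vec n → Vec m → ℝ} {vstar : ℕ → Vec n → ℕ → Vec m}
    {zstar : ℕ → Vec n → Vec n} (hrci : S.IsRCI)
    (hv : ∀ N z, (∃ v, S.Adm N z v) → S.IsOptimalInput ℓ N z (vstar N z))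
    (hz : ∀ N x, S.TubeFeasible N x → S.IsOptimalTubeState ℓ N x (zstar N x))
    {N : ℕ} (hN : 1 ≤ N) {x : ℕ → Vec n} {w : ℕ → Vec q} (hcl : S.IsClosedLoop vstar zstar N x w)
    {t : ℕ} (hf : S.TubeFeasible N (x t)) (hf' : S.TubeFeasible N (x (t + 1))) :
    zstar N (x (t + 1)) ∈ S.Zcl vstar zstar N (zstar N (x t)) :=
  ⟨x (t + 1), (S.sub_fpi_mem_of_isClosedLoop hrci hv hz hN hcl hf).2.2, hf', rfl⟩

/-! ### Bounds from compactness -/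

theorem exists_Lpi_bound (hL : Continuous (fun p : Vec n × Vec m => S.L p.1 p.2))
    (hZ : IsCompact S.Zc) : ∃ B, 0 ≤ B ∧ ∀ z v, (z, v) ∈ S.Zpi → S.Lpi z v ≤ B := by
  obtain ⟨B, hB⟩ := hZ.exists_bound_of_continuousOn hL.continuousOn
  exact ⟨max B 0, le_max_right _ _, fun z v h =>
    (le_abs_self _).trans ((hB _ h).trans (le_max_left _ _))⟩

theorem Lpi_le_Lmax {B : ℝ} (hB : ∀ z v, (z, v) ∈ S.Zpi → S.Lpi z v ≤ B) {x z : Vec n} {v : Vec m}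
    (hx : x - z ∈ S.Ω) (hzv : (z, v) ∈ S.Zbar) : S.Lpi x v ≤ S.Lmax z v := by
  refine le_csSup ⟨B, ?_⟩ ⟨x - z, hx, by simp⟩
  rintro _ ⟨ε, hε, rfl⟩
  exact hB _ _ (hzv ε hε)

theorem Lmax_le {B : ℝ} (hB : ∀ z v, (z, v) ∈ S.Zpi → S.Lpi z v ≤ B) (hΩ : S.Ω.Nonempty)
    {z : Vec n} {v : Vec m} (hzv : (z, v) ∈ S.Zbar) : S.Lmax z v ≤ B := by
  refine csSup_le (hΩ.image _) ?_
  rintro _ ⟨ε, hε, rfl⟩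
  exact hB _ _ (hzv ε hε)

theorem norm_le_tubeRadius (hΩ : IsCompact S.Ω) {ε : Vec n} (hε : ε ∈ S.Ω) :
    ‖ε‖ ≤ S.tubeRadius :=
  le_csSup (hΩ.image continuous_norm).bddAbove ⟨ε, hε, rfl⟩

theorem Lpi_le_add_tubeRadius {κ : ℝ} (hlip : S.LipschitzCost S.Lpi κ) (hΩ : IsCompact S.Ω)
    (hbar : S.Zbar ⊆ S.Zpi) {x z : Vec n} {v : Vec m} (hx : x - z ∈ S.Ω) (hzv : (z, v) ∈ S.Zbar) :
    S.Lpi x v ≤ S.Lpi z v + κ * S.tubeRadius := by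
  have hxv : (x, v) ∈ S.Zpi := by
    have := hzv _ hx
    rwa [add_sub_cancel] at this
  have h1 := (abs_le.1 (hlip.2 x v z v hxv (hbar hzv))).2
  have h2 : pairDist x v z v = ‖x - z‖ := by simp [pairDist]
  have h3 := mul_le_mul_of_nonneg_left (S.norm_le_tubeRadius hΩ hx) hlip.1.le
  rw [h2] at h1
  linarith

/-- A uniform radius allows `β(‖z_0 - zs‖, T)` to be replaced by `β(R, T)`, so that `δ₄` depends on
`T` only; `R > 0` ensures `β(R, ·) ∈ ℒ`. -/
theorem exists_Xinf_bound (hZ : IsCompact S.Zc) (hbar : S.Zbar ⊆ S.Zpi) (zs : Vec n) :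
    ∃ R > 0, ∀ z ∈ S.Xinf, ‖z - zs‖ ≤ R := by
  obtain ⟨R, hR⟩ := hZ.exists_bound_of_continuousOn (f := fun p : Vec n × Vec m => p.1 - zs)
    (by fun_prop)
  refine ⟨max R 1, by positivity, fun z ⟨v, hv⟩ => ?_⟩
  exact (hR _ (hbar (hv 0))).trans (le_max_left _ _)

/-! ### Construction of the steady state problem -/

theorem exists_pairDist_le_subset {s : Set (Vec n × Vec m)} {z : Vec n} {v : Vec m}
    (h : (z, v) ∈ interior s) : ∃ ε > 0, ∀ z' v', pairDist z' v' z v ≤ ε → (z', v') ∈ s := by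
  obtain ⟨ε, hε, H⟩ := Metric.mem_nhds_iff.1 (mem_interior_iff_mem_nhds.1 h)
  refine ⟨ε / 2, by positivity, fun z' v' hd => H ?_⟩
  obtain ⟨h1, h2⟩ := le_pairDist z' v' z v
  rw [Metric.mem_ball, Prod.dist_eq]
  refine max_lt ?_ ?_ <;> rw [dist_eq_norm] <;> simp only <;> linarith

theorem exists_steadyProblem {ℓ : Vec n → Vec m → ℝ} {κl : ℝ} {zs : Vec n} {vs : Vec m}
    {lam : Vec n → ℝ} {αl : ℝ → ℝ} {M : ℕ} {vstar : ℕ → Vec n → ℕ → Vec m}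
    (hbar : S.Zbar ⊆ S.Zpi) (hlip : S.LipschitzCost ℓ κl)
    (hross : S.IsROSS ℓ zs vs) (hint : (zs, vs) ∈ interior S.Zbar) (hnorm : ℓ zs vs = 0)
    (hvstar : ∀ N z, (∃ v, S.Adm N z v) → S.IsOptimalInput ℓ N z (vstar N z))
    (hdiss : S.StrictlyDissipative ℓ zs vs lam αl) (hreach : S.ExpReachable zs vs)
    (hctrl : S.LocallyControllable M zs vs) (hval : S.ValueContinuous ℓ zs) :
    ∃ αV C D, SteadyProblem S ℓ zs vs lam αl αV M vstar C D := by
  obtain ⟨hαl, ⟨C, hC⟩, hd⟩ := hdiss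
  obtain ⟨c, ρ, hc, hρ0, hρ1, hr⟩ := hreach
  obtain ⟨αV, hαV, hV⟩ := hval
  obtain ⟨ε₀, hε₀, hball⟩ := exists_pairDist_le_subset hint
  have hℓ : ∀ z v, (z, v) ∈ S.Zbar → ℓ z v ≤ κl * pairDist z v zs vs := fun z v hzv => by
    have := hlip.2 z v zs vs (hbar hzv) (hbar hross.1)
    rw [hnorm, sub_zero] at this
    exact (le_abs_self _).trans this
  have hzsX : zs ∈ S.Xinf := by
    have ht : ∀ t, S.traj zs (fun _ => vs) t = zs := fun t => by
      induction t with
      | zero => rfl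
      | succ t ih => rw [traj, ih, ← hross.2.1]
    exact ⟨fun _ => vs, fun t => by rw [ht]; exact hross.1⟩
  -- `D` is the Lipschitz constant times the sum of the geometric series of distances.
  refine ⟨αV, C, κl * c * (1 - ρ)⁻¹, hαl, hαV, hC, fun z v hzv => ?_, fun z hz => ?_, hross.1,
    hross.2.1.symm, hnorm, fun ε hε => ?_, hvstar, fun N z hz => ?_⟩
  · have := hd z v hzv
    rwa [hnorm, sub_zero] at this
  · obtain ⟨v, hv, hvρ⟩ := hr z hz
    refine ⟨v, hv, fun K => ?_⟩
    calc S.cost ℓ K z v ≤ ∑ t ∈ Finset.range K, κl * c * ρ ^ t := by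
          refine Finset.sum_le_sum fun t _ => (hℓ _ _ (hv t)).trans ?_
          rw [mul_assoc]
          exact mul_le_mul_of_nonneg_left (hvρ t) hlip.1.le
      _ ≤ κl * c * (1 - ρ)⁻¹ := by
          rw [← Finset.mul_sum, ← tsum_geometric_of_lt_one hρ0 hρ1]
          refine mul_le_mul_of_nonneg_left ?_ (mul_pos hlip.1 hc).le
          exact (summable_geometric_of_lt_one hρ0 hρ1).sum_le_tsum _ fun t _ => pow_nonneg hρ0 t
  · have hpos : 0 < κl * (M + 1) := mul_pos hlip.1 (by positivity)
    -- `ε₀` keeps the path in the tightened set, and the other bound makes each of the `M` stage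
    -- costs at most `ε / (M + 1)`; the `+ 1` covers `M = 0`.
    obtain ⟨r, hr, H⟩ := hctrl (min ε₀ (ε / (κl * (M + 1)))) (lt_min hε₀ (by positivity))
    refine ⟨r, hr, fun y z hy hz => ?_⟩
    obtain ⟨v, hvz, hvd⟩ := H y z hy hz
    have hadm : S.Adm M y v := fun t ht => hball _ _ ((hvd t ht).trans (min_le_left _ _))
    refine ⟨v, hvz, hadm, ?_⟩
    calc S.cost ℓ M y v ≤ ∑ t ∈ Finset.range M, κl * (ε / (κl * (M + 1))) := by
          refine Finset.sum_le_sum fun t ht => ?_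
          have ht := Finset.mem_range.1 ht
          exact (hℓ _ _ (hadm t ht)).trans
            (mul_le_mul_of_nonneg_left ((hvd t ht).trans (min_le_right _ _)) hlip.1.le)
      _ = M / (M + 1) * ε := by
          have := hlip.1
          rw [Finset.sum_const, Finset.card_range, nsmul_eq_mul]
          field_simp
      _ ≤ ε := by
          refine mul_le_of_le_one_left hε.le ?_
          rw [div_le_one (by positivity)]
          linarith
  · have h1 := hV N z hz
    rw [S.V_eq_of_isOptimalInput (hvstar N z (S.feasible_of_mem_Xinf hz N)),
      S.V_eq_of_isOptimalInput (hvstar N zs (S.feasible_of_mem_Xinf hzsX N))] at h1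
    exact_mod_cast h1

/-! ### Well-posedness and performance of the closed loop -/

namespace SteadyProblem

variable {S} {ℓ : Vec n → Vec m → ℝ} {zs : Vec n} {vs : Vec m} {lam : Vec n → ℝ}
  {αl αV : ℝ → ℝ} {M : ℕ} {vstar : ℕ → Vec n → ℕ → Vec m} {C D : ℝ}
  (h : SteadyProblem S ℓ zs vs lam αl αV M vstar C D) {zstar : ℕ → Vec n → Vec n}
  (hz : ∀ N x, S.TubeFeasible N x → S.IsOptimalTubeState ℓ N x (zstar N x)) (hrci : S.IsRCI)
include h hz hrci

/-- Invariance of `Ω` keeps the next real state in the tube around the nominal successor, which lies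
in `𝕏_∞`. -/
theorem eventually_wellPosed_isClosedLoop :
    ∀ᶠ N in atTop, ∀ x w, S.IsClosedLoop vstar zstar N x w →
      (∃ z ∈ S.Xinf, x 0 - z ∈ S.Ω) → ∀ t, S.WellPosedAt zstar N (x t) := by
  filter_upwards [h.eventually_mem_Xinf, h.eventually_wellPosedAt hz, eventually_ge_atTop 1]
    with N hN hwp hN1 x w hcl h0 t
  induction t with
  | zero => exact hwp _ h0
  | succ t ih =>
    refine hwp _ ⟨_, ?_, (S.sub_fpi_mem_of_isClosedLoop hrci h.opt hz hN1 hcl ih.1).2.2⟩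
    exact (hN _ (S.feasible_of_mem_Xinf ih.2 N) (h.optCost_le_bound ih.2 N)).2

/-- Performance of the closed loop, measured by the stage cost along the nominal states. -/
theorem exists_performance_bound {B R : ℝ} (hB0 : 0 ≤ B)
    (hB : ∀ z v, (z, v) ∈ S.Zbar → ℓ z v ≤ B) (hR0 : 0 < R) (hR : ∀ z ∈ S.Xinf, ‖z - zs‖ ≤ R)
    {β : ℝ → ℝ → ℝ} {ε₁ : ℝ → ℝ} (hconv : S.PracticallyConvergent zs vstar zstar β ε₁) :
    ∃ δ₃ δ₄ : ℝ → ℝ, IsL δ₃ ∧ IsL δ₄ ∧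
      ∀ N : ℕ, 1 ≤ N → ∀ x w, S.IsClosedLoop vstar zstar N x w →
        (∃ z ∈ S.Xinf, x 0 - z ∈ S.Ω) → ∀ T : ℕ, (∀ t ≤ T, S.WellPosedAt zstar N (x t)) →
        (∀ v ∈ S.inputsTo zs (max (β ‖zstar N (x 0) - zs‖ T) (ε₁ N)) T (zstar N (x 0)),
          ∑ t ∈ Finset.range T, ℓ (zstar N (x t)) (vstar N (zstar N (x t)) 0) ≤
            S.cost ℓ T (zstar N (x 0)) v + (T * δ₃ N + δ₄ T)) ∧
        ∑ t ∈ Finset.range T, ℓ (zstar N (x t)) (vstar N (zstar N (x t)) 0) ≤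
          S.vinf ℓ (zstar N (x 0)) - S.vinf ℓ (zstar N (x T)) + T * δ₃ N := by
  obtain ⟨hβ, hε₁, hconv⟩ := hconv
  have hC0 : 0 ≤ C := (abs_nonneg _).trans (h.lam_le zs)
  have hD0 : 0 ≤ D := by
    obtain ⟨v, -, hv⟩ := h.cheap zs h.steady_mem_Xinf
    simpa [cost] using hv 0
  -- `Q κ e`: the `κ`-ball around `zs` lies in `𝕏_∞`, and `V_∞` varies there by at most `e`.
  let Q : ℝ → ℝ → Prop := fun κ e => ∀ y z, ‖y - zs‖ ≤ κ → ‖z - zs‖ ≤ κ →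
    y ∈ S.Xinf ∧ S.vinf ℓ y - S.vinf ℓ z ≤ e
  have hQ : ∀ e > 0, ∃ κ > 0, Q κ e := fun e he => by
    obtain ⟨κ, hκ, H⟩ := h.exists_vinf_near (half_pos he)
    refine ⟨κ, hκ, fun y z hy hz => ⟨(H y hy).1, ?_⟩⟩
    have h1 := abs_le.1 (H y hy).2
    have h2 := abs_le.1 (H z hz).2
    linarith
  have hQmono : ∀ {κ κ' e e'}, κ' ≤ κ → e ≤ e' → Q κ e → Q κ' e' :=
    fun hκ he H y z hy hz => ⟨(H y z (hy.trans hκ) (hz.trans hκ)).1,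
      (H y z (hy.trans hκ) (hz.trans hκ)).2.trans he⟩
  let Step : ℕ → ℝ → Prop := fun N e => ∀ z ∈ S.Xinf, ∀ z' ∈ S.Zcl vstar zstar N z,
    z' ∈ S.Xinf → ℓ z (vstar N z 0) ≤ S.vinf ℓ z - S.vinf ℓ z' + e
  let Good : ℕ → Prop := fun N =>
    (∀ x w, S.IsClosedLoop vstar zstar N x w →
      (∃ z ∈ S.Xinf, x 0 - z ∈ S.Ω) → ∀ t, S.WellPosedAt zstar N (x t)) ∧
    ∀ z : ℕ → Vec n, z 0 ∈ S.Xinf → (∀ t, z (t + 1) ∈ S.Zcl vstar zstar N (z t)) →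
      ∀ t : ℕ, ‖z t - zs‖ ≤ max (β ‖z 0 - zs‖ t) (ε₁ N)
  have hGood : ∀ᶠ N in atTop, Good N :=
    (h.eventually_wellPosed_isClosedLoop hz hrci).and hconv
  -- Half of `δ₃` pays for the stage errors, half for the variation of `V_∞` on the `ε₁(N)`-ball.
  -- For horizons too small for the asymptotic estimates, `δ₃ ≥ B + 2C` makes the first estimate
  -- trivial.
  obtain ⟨δ₃, hδ₃, H₃⟩ := exists_isL
    (P := fun N e => 1 ≤ N → Step N (e / 2) ∧ (Good N ∧ Q (ε₁ N) (e / 2) ∨ B + 2 * C ≤ e))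
    (fun N a b hab hP hN => by
      obtain ⟨h1, h2⟩ := hP hN
      refine ⟨fun z hz z' hz' hX => (h1 z hz z' hz' hX).trans (by linarith), ?_⟩
      rcases h2 with h2 | h2
      · exact Or.inl ⟨h2.1, hQmono le_rfl (by linarith) h2.2⟩
      · exact Or.inr (h2.trans hab))
    (fun e he => by
      obtain ⟨κ, hκ, hQκ⟩ := hQ (e / 2) (half_pos he)
      filter_upwards [h.eventually_stage_cost_le hz (half_pos he), hGood,
        (hε₁.2.2.comp tendsto_natCast_atTop_atTop).eventually_lt_const hκ] with N h1 h2 h3 _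
      exact ⟨fun z hz z' hz' _ => h1 z hz z' hz', Or.inl ⟨h2, hQmono h3.le le_rfl hQκ⟩⟩)
  -- The fallback `D + 4C` bounds `V_∞(z_0) - V_∞(z_T) ≤ D + 2C` together with `J_T ≥ -2C`.
  obtain ⟨δ₄, hδ₄, H₄⟩ := exists_isL (P := fun T e => Q (β R T) e ∨ D + 4 * C ≤ e)
    (fun T a b hab hP => hP.imp (hQmono le_rfl hab) fun h => h.trans hab)
    (fun e he => by
      obtain ⟨κ, hκ, hQκ⟩ := hQ e he
      filter_upwards [((hβ.2 R hR0).2.2.comp tendsto_natCast_atTop_atTop).eventually_lt_const hκ]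
        with T hT
      exact Or.inl (hQmono hT.le le_rfl hQκ))
  refine ⟨δ₃, δ₄, hδ₃, hδ₄, fun N hN x w hcl h0 T hwp => ?_⟩
  set z : ℕ → Vec n := fun t => zstar N (x t) with hzdef
  have hzX : ∀ t ≤ T, z t ∈ S.Xinf := fun t ht => (hwp t ht).2
  have hbar : ∀ t ≤ T, (z t, vstar N (z t) 0) ∈ S.Zbar := fun t ht =>
    (S.sub_fpi_mem_of_isClosedLoop hrci h.opt hz hN hcl (hwp t ht).1).1
  have hZcl : ∀ t < T, z (t + 1) ∈ S.Zcl vstar zstar N (z t) := fun t ht =>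
    S.mem_Zcl_of_isClosedLoop hrci h.opt hz hN hcl (hwp t ht.le).1 (hwp (t + 1) ht).1
  obtain ⟨hstep, hcase⟩ : Step N (δ₃ N / 2) ∧
      (Good N ∧ Q (ε₁ N) (δ₃ N / 2) ∨ B + 2 * C ≤ δ₃ N) := by
    refine H₃ N ⟨2 * (B + D + 2 * C), fun _ => ⟨fun y hy y' hy' hX => ?_, Or.inr (by linarith)⟩⟩ hN
    have h1 := h.vinf_le_bound hX
    have h2 := h.neg_le_vinf hy
    have h3 := hB y (vstar N y 0) ((h.opt N y (S.feasible_of_mem_Xinf hy N)).1 0 hN)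
    linarith
  have hcase₄ : Q (β R T) (δ₄ T) ∨ D + 4 * C ≤ δ₄ T := H₄ T ⟨D + 4 * C, Or.inr le_rfl⟩
  have hδ₃0 : 0 < δ₃ N := hδ₃.pos N.cast_nonneg
  have hδ₄0 : 0 < δ₄ T := hδ₄.pos T.cast_nonneg
  have htel : ∑ t ∈ Finset.range T, ℓ (z t) (vstar N (z t) 0) ≤
      S.vinf ℓ (z 0) - S.vinf ℓ (z T) + T * (δ₃ N / 2) := by
    have : ∀ k ≤ T, ∑ t ∈ Finset.range k, ℓ (z t) (vstar N (z t) 0) ≤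
        S.vinf ℓ (z 0) - S.vinf ℓ (z k) + k * (δ₃ N / 2) := by
      intro k
      induction k with
      | zero => intro _; simp
      | succ k ih =>
        intro hk
        have h1 := hstep _ (hzX k (by omega)) _ (hZcl k (by omega)) (hzX (k + 1) hk)
        rw [Finset.sum_range_succ]
        push_cast
        linarith [ih (by omega)]
    exact this T le_rfl
  have hTδ : 0 ≤ T * (δ₃ N / 2) := by positivity
  refine ⟨fun v hv => ?_, by linarith⟩
  obtain ⟨hadm, hnear⟩ := hv
  -- `T = 0` is separate because the end-point error is absorbed in `T * (δ₃ N / 2)`.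
  rcases Nat.eq_zero_or_pos T with rfl | hT
  · simpa [cost] using hδ₄0.le
  have hT1 : (1 : ℝ) ≤ T := by exact_mod_cast hT
  have hlow := h.neg_le_cost hadm
  rcases hcase with ⟨hgood, hQN⟩ | hcrude
  · have hnearT : ‖z T - zs‖ ≤ max (β ‖z 0 - zs‖ T) (ε₁ N) := by
      -- Practical convergence concerns infinite sequences, so well-posedness is also needed after
      -- time `T`.
      have hwp' := hgood.1 x w hcl h0
      exact hgood.2 z (hzX 0 (Nat.zero_le _)) (fun t =>
        S.mem_Zcl_of_isClosedLoop hrci h.opt hz hN hcl (hwp' t).1 (hwp' (t + 1)).1) T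
    have hfin : ∀ e, Q (max (β ‖z 0 - zs‖ T) (ε₁ N)) e →
        S.vinf ℓ (z 0) - S.vinf ℓ (z T) ≤ S.cost ℓ T (z 0) v + e := fun e hQe => by
      obtain ⟨hX, hle⟩ := hQe _ _ hnear hnearT
      have h1 := h.vinf_le_add hadm hX
      linarith
    -- The end-point error is charged to `δ₃` if `ε₁(N)` dominates, and to `δ₄` otherwise.
    rcases le_total (β ‖z 0 - zs‖ T) (ε₁ N) with hle | hle
    · have h1 := hfin (δ₃ N / 2) (by rwa [max_eq_right hle])
      have h2 : δ₃ N / 2 ≤ T * (δ₃ N / 2) := le_mul_of_one_le_left (by positivity) hT1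
      linarith
    · rcases hcase₄ with hQT | hcrude₄
      · have hβR : β ‖z 0 - zs‖ T ≤ β R T :=
          (hβ.1 T T.cast_nonneg).mono (norm_nonneg _) (hR _ (hzX 0 (Nat.zero_le _)))
        have h1 := hfin (δ₄ T) (by rw [max_eq_left hle]; exact hQmono hβR le_rfl hQT)
        linarith
      · have h1 := h.vinf_le_bound (hzX 0 (Nat.zero_le _))
        have h2 := h.neg_le_vinf (hzX T le_rfl)
        linarith
  · have h1 : ∑ t ∈ Finset.range T, ℓ (z t) (vstar N (z t) 0) ≤ T * B := by
      refine (Finset.sum_le_sum fun t ht => hB _ _ (hbar t (Finset.mem_range.1 ht).le)).trans ?_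
      simp
    have h2 : T * (B + 2 * C) ≤ T * δ₃ N := mul_le_mul_of_nonneg_left hcrude (by positivity)
    have h3 : 2 * C ≤ T * (2 * C) := le_mul_of_one_le_left (by positivity) hT1
    linarith

end SteadyProblem

/-- A real bound on the nominal stage costs gives the extended real performance estimates. -/
theorem realCost_le {ℓ : Vec n → Vec m → ℝ} {vstar : ℕ → Vec n → ℕ → Vec m}
    {zstar : ℕ → Vec n → Vec n} {N T : ℕ} {x : ℕ → Vec n} {E : ℝ}
    (hE : ∀ t < T, S.Lpi (x t) (vstar N (zstar N (x t)) 0) ≤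
      ℓ (zstar N (x t)) (vstar N (zstar N (x t)) 0) + E) :
    S.realCost vstar zstar N x T ≤
      ∑ t ∈ Finset.range T, ℓ (zstar N (x t)) (vstar N (zstar N (x t)) 0) + T * E := by
  refine (Finset.sum_le_sum fun t ht => hE t (Finset.mem_range.1 ht)).trans ?_
  simp [Finset.sum_add_distrib]

theorem coe_le_iInf_add {X : Type*} {s : Set X} {g : X → ℝ} {a b : ℝ}
    (h : ∀ v ∈ s, a ≤ g v + b) : (a : EReal) ≤ (⨅ v ∈ s, (g v : EReal)) + (b : EReal) := by
  have : ((a - b : ℝ) : EReal) ≤ ⨅ v ∈ s, (g v : EReal) := le_iInf₂ fun v hv => by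
    have := h v hv
    exact_mod_cast (show a - b ≤ g v by linarith)
  calc (a : EReal) = ((a - b : ℝ) : EReal) + (b : EReal) := by
        rw [← EReal.coe_add, sub_add_cancel]
    _ ≤ _ := add_le_add this le_rfl

end Data

end TubeMPC

/-! ### The corollary -/

open TubeMPC TubeMPC.Data in
theorem mainTheorem7 {n m q : ℕ} (S : Data n m q)
    (ℓ : Vec n → Vec m → ℝ) (κl : ℝ) (zs : Vec n) (vs : Vec m)
    (lam : Vec n → ℝ) (αl : ℝ → ℝ) (M : ℕ)
    (vstar : ℕ → Vec n → ℕ → Vec m) (zstar : ℕ → Vec n → Vec n)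
    (hL : Continuous (fun p : Vec n × Vec m => S.L p.1 p.2))
    (hcost : ℓ = S.Lmax ∨ ℓ = S.Lpi)
    (hsets : S.ConstraintSets)
    (htube : S.TubeSets)
    (hlip : S.LipschitzCost ℓ κl)
    (hross : S.IsROSS ℓ zs vs)
    (hint : (zs, vs) ∈ interior S.Zbar)
    (hnorm : ℓ zs vs = 0)
    (hvstar : ∀ N z, (∃ v, S.Adm N z v) → S.IsOptimalInput ℓ N z (vstar N z))
    (hzstar : ∀ N x, S.TubeFeasible N x → S.IsOptimalTubeState ℓ N x (zstar N x))
    (hdiss : S.StrictlyDissipative ℓ zs vs lam αl)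
    (hcldiss : S.ClosedLoopDissipative ℓ zs vs lam αl vstar zstar)
    (hreach : S.ExpReachable zs vs)
    (hctrl : S.LocallyControllable M zs vs)
    (hval : S.ValueContinuous ℓ zs) :
    (∀ z ∈ S.Xinf, S.Vinf ℓ z ≠ ⊤ ∧ S.Vinf ℓ z ≠ ⊥) ∧
    (∃ N₀ : ℕ, ∀ N ≥ N₀, ∀ x w, S.IsClosedLoop vstar zstar N x w →
      (∃ z ∈ S.Xinf, x 0 - z ∈ S.Ω) → ∀ t, S.WellPosedAt zstar N (x t)) ∧
    (∃ β ε₁, S.PracticallyConvergent zs vstar zstar β ε₁) ∧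
    ∀ β ε₁, S.PracticallyConvergent zs vstar zstar β ε₁ →
      ∃ δ₃ δ₄ : ℝ → ℝ, IsL δ₃ ∧ IsL δ₄ ∧
        ∀ N : ℕ, 1 ≤ N → ∀ x w, S.IsClosedLoop vstar zstar N x w →
          (∃ z ∈ S.Xinf, x 0 - z ∈ S.Ω) →
          ∀ T : ℕ, (∀ t ≤ T, S.WellPosedAt zstar N (x t)) →
            (ℓ = S.Lmax →
              (S.realCost vstar zstar N x T : EReal) ≤
                (⨅ v ∈ S.inputsTo zs (max (β ‖zstar N (x 0) - zs‖ T) (ε₁ N)) T (zstar N (x 0)),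
                  (S.cost ℓ T (zstar N (x 0)) v : EReal))
                + ((T * δ₃ N + δ₄ T : ℝ) : EReal) ∧
              (S.realCost vstar zstar N x T : EReal) ≤
                S.Vinf ℓ (zstar N (x 0)) - S.Vinf ℓ (zstar N (x T))
                + ((T * δ₃ N : ℝ) : EReal)) ∧
            (ℓ = S.Lpi →
              (S.realCost vstar zstar N x T : EReal) ≤
                (⨅ v ∈ S.inputsTo zs (max (β ‖zstar N (x 0) - zs‖ T) (ε₁ N)) T (zstar N (x 0)),
                  (S.cost ℓ T (zstar N (x 0)) v : EReal))
                + ((T * δ₃ N + δ₄ T + T * κl * S.tubeRadius : ℝ) : EReal) ∧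
              (S.realCost vstar zstar N x T : EReal) ≤
                S.Vinf ℓ (zstar N (x 0)) - S.Vinf ℓ (zstar N (x T))
                + ((T * δ₃ N + T * κl * S.tubeRadius : ℝ) : EReal)) := by
  obtain ⟨αV, C, D, h⟩ := S.exists_steadyProblem (vstar := vstar) htube.2.2.2 hlip hross hint hnorm
    hvstar hdiss hreach hctrl hval
  obtain ⟨hrci, hΩint, -, hbar⟩ := htube
  have hΩ : S.Ω.Nonempty := hΩint.mono interior_subset
  refine ⟨fun z hz => ?_, eventually_atTop.1 (h.eventually_wellPosed_isClosedLoop hzstar hrci),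
    h.exists_practicallyConvergent hzstar hcldiss, fun β ε₁ hconv => ?_⟩
  · rw [← h.coe_vinf hz]
    exact ⟨EReal.coe_ne_top _, EReal.coe_ne_bot _⟩
  obtain ⟨B, hB0, hB⟩ := S.exists_Lpi_bound hL hsets.1
  obtain ⟨R, hR0, hR⟩ := S.exists_Xinf_bound hsets.1 hbar zs
  have hℓB : ∀ z v, (z, v) ∈ S.Zbar → ℓ z v ≤ B := fun z v hzv => by
    rcases hcost with rfl | rfl
    · exact S.Lmax_le hB hΩ hzv
    · exact hB z v (hbar hzv)
  obtain ⟨δ₃, δ₄, hδ₃, hδ₄, H⟩ := h.exists_performance_bound hzstar hrci hB0 hℓB hR0 hR hconv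
  refine ⟨δ₃, δ₄, hδ₃, hδ₄, fun N hN x w hcl h0 T hwp => ?_⟩
  obtain ⟨H1, H2⟩ := H N hN x w hcl h0 T hwp
  have hmem := fun t (ht : t < T) =>
    S.sub_fpi_mem_of_isClosedLoop hrci hvstar hzstar hN hcl (hwp t ht.le).1
  -- `E` is the excess of the real over the nominal stage cost: `0` for `Lmax`, `κl * tubeRadius`
  -- for `Lpi`.
  have key : ∀ E : ℝ, (∀ t < T, S.Lpi (x t) (vstar N (zstar N (x t)) 0) ≤
      ℓ (zstar N (x t)) (vstar N (zstar N (x t)) 0) + E) →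
      (S.realCost vstar zstar N x T : EReal) ≤
        (⨅ v ∈ S.inputsTo zs (max (β ‖zstar N (x 0) - zs‖ T) (ε₁ N)) T (zstar N (x 0)),
          (S.cost ℓ T (zstar N (x 0)) v : EReal))
        + ((T * δ₃ N + δ₄ T + T * E : ℝ) : EReal) ∧
      (S.realCost vstar zstar N x T : EReal) ≤
        S.Vinf ℓ (zstar N (x 0)) - S.Vinf ℓ (zstar N (x T))
        + ((T * δ₃ N + T * E : ℝ) : EReal) := fun E hE => by
    have h1 := S.realCost_le hE
    refine ⟨coe_le_iInf_add fun v hv => by linarith [H1 v hv], ?_⟩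
    rw [← h.coe_vinf (hwp 0 (Nat.zero_le _)).2, ← h.coe_vinf (hwp T le_rfl).2]
    exact_mod_cast (show S.realCost vstar zstar N x T ≤ S.vinf ℓ (zstar N (x 0)) -
      S.vinf ℓ (zstar N (x T)) + (T * δ₃ N + T * E) by linarith)
  constructor
  · intro hℓ
    have := key 0 fun t ht => by
      rw [hℓ, add_zero]
      exact S.Lpi_le_Lmax hB (hmem t ht).2.1 (hmem t ht).1
    simpa only [mul_zero, add_zero] using this
  · intro hℓ
    have := key (κl * S.tubeRadius) fun t ht => by
      rw [hℓ] at hlip ⊢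
      exact S.Lpi_le_add_tubeRadius hlip hrci.1 hbar (hmem t ht).2.1 (hmem t ht).1
    simpa only [← mul_assoc] using this
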